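/- \textbf{Conventions.} Let $\mathbb{F}\in\{\mathbb{R},\mathbb{C}\}$, $d\in\mathbb{N}$, and write $\|z\|^2=\sum_{i=1}^d z_i^2$ for $z\in\mathbb{F}^d$ (no complex conjugation). A realisation of a finite simple graph $G=(V,E)$ is a map $p:V\to\mathbb{F}^d$; it is \emph{generic} if its $d|V|$ coordinates are algebraically independent over $\mathbb{Q}$. Realisations $p,q$ of $G$ are \emph{equivalent} if $\|p(v)-p(w)\|^2=\|q(v)-q(w)\|^2$ for all $vw\in E$, and \emph{congruent} if $q(v)=Ap(v)+b$ for all $v\in V$, for some $b\in\mathbb{F}^d$ and some $d\times d$ matrix $A$ over $\mathbb{F}$ with $A^TA=AA^T=I$. The framework $(G,p)$ is \emph{rigid} if for every $\varepsilon>0$ and every continuous path $\rho:(-\varepsilon,\varepsilon)\to(\mathbb{F}^d)^V$ with $\rho_0=p$ and all $\rho_t$ equivalent to $p$, all $\rho_t$ are congruent to $p$. It is \emph{infinitesimally rigid} if its rigidity matrix (the $|E|\times d|V|$ matrix whose row for $uv\in E$ is $p(u)-p(v)$ in the columns of $u$, $p(v)-p(u)$ in the columns of $v$, and $0$ elsewhere)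 has rank $d|V|-\binom{d+1}{2}$, or if $G$ is a complete graph on at most $d+1$ vertices placed at affinely independent points. The graph $G$ is \emph{$d$-rigid} if some generic framework $(G,p)$ in $\mathbb{R}^d$ or $\mathbb{C}^d$ is rigid, and \emph{minimally $d$-rigid} if moreover $G-e$ is not $d$-rigid for any $e\in E$. For $|V|\ge d+1$, the \emph{$d$-realisation number} $c_d(G)\in\mathbb{N}\cup\{\infty\}$ is the number of congruence classes of realisations in $\mathbb{C}^d$ equivalent to $p$, for any generic $p:V\to\mathbb{C}^d$ (this does not depend on $p$). Given a vertex $x$ of $G$ and a partition of its neighbourhood into (possibly empty) sets $N_1,N_2$ and a set $\{w_1,\dots,w_d\}$ of $d$ distinct vertices, the \emph{$d$-dimensional spider-split} of $G$ is the graph $G'$ obtained from $G-x$ by adding two new vertices $x_1,x_2$, joining $x_i$ to all of $N_i\cup\{w_1,\dots,w_d\}$ for $i=1,2$. For a realisation $q$ of $G$, let $q'$ be the degenerate realisation of $G'$ with $q'(v)=q(v)$ for $v\in V\setminus\{x\}$ and $q'(x_1)=q'(x_2)=q(x)$. \textbf{Theorem.} Let $G=(V,E)$ be minimally $d$-rigid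 with at least $d+1$ vertices and let $G'$ be formed from $G$ by a $d$-dimensional spider-split. Then $G'$ is $d$-rigid and \[ c_d(G')\ \ge\ c_d(G). \] Moreover, for every generic $p\in(\mathbb{C}^d)^V$ and every $q\in(\mathbb{C}^d)^V$ equivalent to $p$, the framework $(G',q')$ is infinitesimally rigid, and it persists: for every neighbourhood $U$ of $q'$ there is a neighbourhood $W$ of $p'$ such that every $r\in W$ is equivalent, as a realisation of $G'$, to some $s\in U$. -/

import Mathlib

namespace BarJoint

/-! ### Frameworks -/

/-- Realisations of a vertex set `V` in `F^d`. -/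
abbrev Realisation (V : Type*) (d : ℕ) (F : Type*) := V → Fin d → F

/-- The quadratic form `‖x - y‖² = ∑ (x_i - y_i)²` on `F^d`. Over `ℂ` there is no conjugation. -/
def sqDist {d : ℕ} {F : Type*} [Field F] (x y : Fin d → F) : F :=
  ∑ i, (x i - y i) ^ 2

/-- The coordinates of `p` form an algebraically independent family over `ℚ`. -/
def IsGeneric {V : Type*} {d : ℕ} {F : Type*} [Field F] [CharZero F]
    (p : Realisation V d F) : Prop :=
  AlgebraicIndependent ℚ (fun vi : V × Fin d => p vi.1 vi.2)

/-- Two realisations of `G` are equivalent if all edges of `G` have the same squared length. -/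
def Equivalent {V : Type*} {d : ℕ} {F : Type*} [Field F] (G : SimpleGraph V)
    (p q : Realisation V d F) : Prop :=
  ∀ v w, G.Adj v w → sqDist (p v) (p w) = sqDist (q v) (q w)

/-- Two realisations are congruent if some isometry `x ↦ A x + b`, with `A` in the orthogonal
group (for the transpose, not the conjugate transpose), sends one to the other. -/
def Congruent {V : Type*} {d : ℕ} {F : Type*} [Field F] (p q : Realisation V d F) : Prop :=
  ∃ (A : Matrix (Fin d) (Fin d) F) (b : Fin d → F),
    A.transpose * A = 1 ∧ A * A.transpose = 1 ∧ ∀ v, q v = A.mulVec (p v) + b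

/-- A continuous flex of `(G, p)` on the interval `(-ε, ε)`. -/
structure IsContinuousFlex {V : Type*} {d : ℕ} {F : Type*} [Field F] [TopologicalSpace F]
    (G : SimpleGraph V) (p : Realisation V d F) (ε : ℝ) (ρ : ℝ → Realisation V d F) : Prop where
  pos : 0 < ε
  continuousOn : ContinuousOn ρ (Set.Ioo (-ε) ε)
  zero : ρ 0 = p
  equivalent : ∀ t ∈ Set.Ioo (-ε) ε, Equivalent G p (ρ t)

/-- `(G, p)` is rigid if every continuous flex consists of realisations congruent to `p`. -/
def IsRigidFramework {V : Type*} {d : ℕ} {F : Type*} [Field F] [TopologicalSpace F]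
    (G : SimpleGraph V) (p : Realisation V d F) : Prop :=
  ∀ (ε : ℝ) (ρ : ℝ → Realisation V d F), IsContinuousFlex G p ε ρ →
    ∀ t ∈ Set.Ioo (-ε) ε, Congruent p (ρ t)

open Classical in
/-- The rigidity matrix: the row of the edge `uv` is `p u - p v` in the columns of `u`,
`p v - p u` in the columns of `v`, and zero elsewhere. -/
noncomputable def rigidityMatrix {V : Type*} {d : ℕ} {F : Type*} [Field F]
    (G : SimpleGraph V) (p : Realisation V d F) : Matrix G.edgeSet (V × Fin d) F :=
  fun e vi =>
    if h : vi.1 ∈ (e : Sym2 V) then p vi.1 vi.2 - p (Sym2.Mem.other h) vi.2 else 0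

/-- `(G, p)` is infinitesimally rigid if its rigidity matrix has rank `d|V| - (d+1 choose 2)`,
or it is a simplex on at most `d + 1` affinely independent vertices. -/
def IsInfinitesimallyRigid {V : Type*} [Fintype V] {d : ℕ} {F : Type*} [Field F]
    (G : SimpleGraph V) (p : Realisation V d F) : Prop :=
  (rigidityMatrix G p).rank + (d + 1).choose 2 = d * Fintype.card V ∨
    (G = ⊤ ∧ Fintype.card V ≤ d + 1 ∧ AffineIndependent F p)

/-! ### Rigid graphs -/

/-- `G` is `d`-rigid if some generic framework `(G, p)` in `ℝ^d` or in `ℂ^d` is rigid. -/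
def IsRigid {V : Type*} (d : ℕ) (G : SimpleGraph V) : Prop :=
  (∃ p : Realisation V d ℝ, IsGeneric p ∧ IsRigidFramework G p) ∨
    (∃ p : Realisation V d ℂ, IsGeneric p ∧ IsRigidFramework G p)

/-- `G` is `d`-rigid, and deleting any edge destroys this. -/
def IsMinimallyRigid {V : Type*} (d : ℕ) (G : SimpleGraph V) : Prop :=
  IsRigid d G ∧ ∀ e ∈ G.edgeSet, ¬ IsRigid d (G.deleteEdges {e})

/-! ### Realisation numbers -/

theorem Congruent.refl {V : Type*} {d : ℕ} {F : Type*} [Field F] (p : Realisation V d F) :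
    Congruent p p :=
  ⟨1, 0, by simp, by simp, by simp⟩

theorem Congruent.symm {V : Type*} {d : ℕ} {F : Type*} [Field F] {p q : Realisation V d F}
    (h : Congruent p q) : Congruent q p := by
  obtain ⟨A, b, h1, h2, h3⟩ := h
  refine ⟨A.transpose, -(A.transpose.mulVec b), by simpa using h2, by simpa using h1, ?_⟩
  intro v
  rw [h3 v, Matrix.mulVec_add, Matrix.mulVec_mulVec, h1, Matrix.one_mulVec]
  simp

theorem Congruent.trans {V : Type*} {d : ℕ} {F : Type*} [Field F] {p q r : Realisation V d F}
    (h : Congruent p q) (h' : Congruent q r) : Congruent p r := by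
  obtain ⟨A, b, h1, h2, h3⟩ := h
  obtain ⟨B, c, k1, k2, k3⟩ := h'
  refine ⟨B * A, B.mulVec b + c, ?_, ?_, ?_⟩
  · rw [Matrix.transpose_mul, Matrix.mul_assoc, ← Matrix.mul_assoc B.transpose, k1,
      Matrix.one_mul, h1]
  · rw [Matrix.transpose_mul, Matrix.mul_assoc, ← Matrix.mul_assoc A, h2, Matrix.one_mul, k2]
  · intro v
    rw [k3 v, h3 v, Matrix.mulVec_add, Matrix.mulVec_mulVec, add_assoc]

/-- Congruence on the fibre of all complex realisations equivalent to `p`. -/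
def congruenceSetoid {V : Type*} {d : ℕ} (G : SimpleGraph V) (p : Realisation V d ℂ) :
    Setoid {q : Realisation V d ℂ // Equivalent G p q} where
  r q q' := Congruent q.1 q'.1
  iseqv := ⟨fun q => Congruent.refl q.1, Congruent.symm, Congruent.trans⟩

/-- The realisation space `C_d(G, p)`: complex realisations equivalent to `p`, up to congruence. -/
def RealisationSpace {V : Type*} {d : ℕ} (G : SimpleGraph V) (p : Realisation V d ℂ) : Type _ :=
  Quotient (congruenceSetoid G p)

theorem exists_isGeneric (V : Type*) [Finite V] (d : ℕ) :
    ∃ p : Realisation V d ℂ, IsGeneric p := by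
  obtain ⟨s, hs⟩ := exists_isTranscendenceBasis ℚ ℂ
  have hc : Cardinal.mk ℂ = Cardinal.mk s :=
    IsAlgClosed.cardinal_eq_cardinal_transcendence_basis_of_aleph0_lt' _ hs (by simp)
      (by rw [Cardinal.mk_complex]; exact Cardinal.aleph0_lt_continuum)
  have hinf : Infinite s := by
    rw [Cardinal.infinite_iff, ← hc]
    exact Cardinal.aleph0_le_mk ℂ
  have e : (V × Fin d) ↪ s :=
    (Finite.equivFin (V × Fin d)).toEmbedding.trans (Fin.valEmbedding.trans (Infinite.natEmbedding s))
  exact ⟨fun v i => (e (v, i) : ℂ), hs.1.comp e e.injective⟩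

open Classical in
/-- The complex `d`-realisation number. For `|V| ≥ d + 1` it is `|C_d(G, p)|` for a generic `p`;
by `realisationNumber_eq` below the choice of `p` is immaterial. -/
noncomputable def realisationNumber {V : Type*} [Fintype V] (d : ℕ) (G : SimpleGraph V) : ℕ∞ :=
  if d + 1 ≤ Fintype.card V then
    ENat.card (RealisationSpace G (exists_isGeneric V d).choose)
  else if G = ⊤ then 1 else ⊤

/-- Any two generic points are exchanged by an automorphism of `ℂ`. -/
theorem exists_ringEquiv {ι : Type*} [Finite ι] {a b : ι → ℂ} (ha : AlgebraicIndependent ℚ a)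
    (hb : AlgebraicIndependent ℚ b) : ∃ σ : ℂ ≃+* ℂ, ∀ i, σ (a i) = b i := by
  obtain ⟨s, has, hs⟩ := exists_isTranscendenceBasis_superset (AlgebraicIndependent.to_subtype_range ha)
  obtain ⟨t, hbt, ht⟩ := exists_isTranscendenceBasis_superset (AlgebraicIndependent.to_subtype_range hb)
  have key : ∀ {s : Set ℂ}, IsTranscendenceBasis ℚ ((↑) : s → ℂ) → Cardinal.mk ℂ = Cardinal.mk s :=
    fun hs => IsAlgClosed.cardinal_eq_cardinal_transcendence_basis_of_aleph0_lt' _ hs (by simp)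
      (by rw [Cardinal.mk_complex]; exact Cardinal.aleph0_lt_continuum)
  have hinf : Infinite s := by
    rw [Cardinal.infinite_iff, ← key hs]
    exact Cardinal.aleph0_le_mk ℂ
  let a' : ι → s := fun i => ⟨a i, has ⟨i, rfl⟩⟩
  let b' : ι → t := fun i => ⟨b i, hbt ⟨i, rfl⟩⟩
  have ha' : Function.Injective a' := fun i j h => ha.injective (congrArg Subtype.val h)
  have hb' : Function.Injective b' := fun i j h => hb.injective (congrArg Subtype.val h)
  let f : Set.range a' ↪ t :=
    (Equiv.ofInjective a' ha').symm.toEmbedding.trans ⟨b', hb'⟩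
  obtain ⟨g, hg⟩ := Cardinal.extend_function_of_lt f
    ((Cardinal.lt_aleph0_of_finite _).trans_le (Cardinal.aleph0_le_mk s))
    (Cardinal.eq.1 ((key hs).symm.trans (key ht)))
  have hga : ∀ i, g (a' i) = b' i := by
    intro i
    have := hg ⟨a' i, i, rfl⟩
    rw [this]
    have h2 : (Equiv.ofInjective a' ha').symm ⟨a' i, i, rfl⟩ = i :=
      Equiv.ofInjective_symm_apply ha' i
    simp [f, h2]
  let _ := IsAlgClosed.isAlgClosure_of_transcendence_basis ((↑) : s → ℂ) hs
  let _ := IsAlgClosed.isAlgClosure_of_transcendence_basis ((↑) : t → ℂ) ht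
  let E : Algebra.adjoin ℚ (Set.range ((↑) : s → ℂ)) ≃ₐ[ℚ]
      Algebra.adjoin ℚ (Set.range ((↑) : t → ℂ)) :=
    hs.1.aevalEquiv.symm.trans ((MvPolynomial.renameEquiv ℚ g).trans ht.1.aevalEquiv)
  refine ⟨IsAlgClosure.equivOfEquiv ℂ ℂ E.toRingEquiv, fun i => ?_⟩
  have e1 : a i = algebraMap _ ℂ (hs.1.aevalEquiv (MvPolynomial.X (a' i))) := by
    rw [AlgebraicIndependent.algebraMap_aevalEquiv, MvPolynomial.aeval_X]
  have e2 : E.toRingEquiv (hs.1.aevalEquiv (MvPolynomial.X (a' i))) =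
      ht.1.aevalEquiv (MvPolynomial.X (b' i)) := by
    change ht.1.aevalEquiv (MvPolynomial.renameEquiv ℚ g
      (hs.1.aevalEquiv.symm (hs.1.aevalEquiv (MvPolynomial.X (a' i))))) = _
    rw [AlgEquiv.symm_apply_apply, MvPolynomial.renameEquiv_apply, MvPolynomial.rename_X, hga]
  rw [e1, IsAlgClosure.equivOfEquiv_algebraMap, e2, AlgebraicIndependent.algebraMap_aevalEquiv,
    MvPolynomial.aeval_X]

theorem sqDist_map {d : ℕ} (σ : ℂ ≃+* ℂ) (x y : Fin d → ℂ) :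
    sqDist (fun i => σ (x i)) (fun i => σ (y i)) = σ (sqDist x y) := by
  simp [sqDist]

theorem Equivalent.map {V : Type*} {d : ℕ} {G : SimpleGraph V} {p q : Realisation V d ℂ}
    (σ : ℂ ≃+* ℂ) (h : Equivalent G p q) :
    Equivalent G (fun v i => σ (p v i)) (fun v i => σ (q v i)) := by
  intro v w hvw
  rw [sqDist_map, sqDist_map, h v w hvw]

theorem Congruent.map {V : Type*} {d : ℕ} {p q : Realisation V d ℂ}
    (σ : ℂ ≃+* ℂ) (h : Congruent p q) :
    Congruent (fun v i => σ (p v i)) (fun v i => σ (q v i)) := by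
  obtain ⟨A, b, h1, h2, h3⟩ := h
  refine ⟨A.map σ, fun i => σ (b i), ?_, ?_, ?_⟩
  · rw [← Matrix.transpose_map, ← Matrix.map_mul, h1]
    simp
  · rw [← Matrix.transpose_map, ← Matrix.map_mul, h2]
    simp
  · intro v
    ext i
    simp [h3 v, Matrix.mulVec, dotProduct]

/-- The number `|C_d(G, p)|` is the same for all generic `p`, so that `realisationNumber` is
well defined. -/
theorem realisationNumber_eq {V : Type*} [Fintype V] {d : ℕ} (hV : d + 1 ≤ Fintype.card V)
    (G : SimpleGraph V) {p : Realisation V d ℂ} (hp : IsGeneric p) :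
    realisationNumber d G = ENat.card (RealisationSpace G p) := by
  rw [realisationNumber, if_pos hV]
  obtain ⟨σ, hσ⟩ := exists_ringEquiv (exists_isGeneric V d).choose_spec hp
  generalize (exists_isGeneric V d).choose = p₀ at hσ
  have h1 : (fun v i => σ (p₀ v i)) = p := by
    funext v i
    exact hσ (v, i)
  subst h1
  refine ENat.card_congr (Quotient.congr
    { toFun := fun q => ⟨fun v i => σ (q.1 v i), q.2.map σ⟩
      invFun := fun q => ⟨fun v i => σ.symm (q.1 v i), by simpa using q.2.map σ.symm⟩
      left_inv := fun q => by simp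
      right_inv := fun q => by simp } fun q q' => ⟨fun h => Congruent.map σ h, fun h => ?_⟩)
  have h2 : Congruent (fun v i => σ (q.1 v i)) (fun v i => σ (q'.1 v i)) := h
  have h3 := h2.map σ.symm
  simp only [RingEquiv.symm_apply_apply] at h3
  exact h3

/-! ### Spider-splits -/

/-- The neighbourhood of `x` is partitioned into `N₁`, `N₂` and the set `{w_1, …, w_d}` of `d`
distinct vertices; `N₁` and `N₂` may be empty. -/
structure IsSpiderPartition {V : Type*} {d : ℕ} (G : SimpleGraph V) (x : V) (N₁ N₂ : Set V)
    (w : Fin d → V) : Prop where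
  injective : Function.Injective w
  union_eq : N₁ ∪ N₂ ∪ Set.range w = G.neighborSet x
  disjoint₁₂ : Disjoint N₁ N₂
  disjoint₁ : Disjoint N₁ (Set.range w)
  disjoint₂ : Disjoint N₂ (Set.range w)

/-- Vertices after splitting `x`: those of `G - x`, and two new ones `x₁ = inr 0`, `x₂ = inr 1`. -/
abbrev SplitVertex {V : Type*} (x : V) := {v : V // v ≠ x} ⊕ Fin 2

/-- The spider-split: `G - x` together with `x₁` joined to `N₁ ∪ {w_1, …, w_d}` and `x₂` joined
to `N₂ ∪ {w_1, …, w_d}`. There is no edge between `x₁` and `x₂`. -/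
def spiderSplit {V : Type*} {d : ℕ} (G : SimpleGraph V) (x : V) (N₁ N₂ : Set V)
    (w : Fin d → V) : SimpleGraph (SplitVertex x) where
  Adj
    | .inl u, .inl v => G.Adj u v
    | .inl u, .inr i => (u : V) ∈ (![N₁, N₂] i) ∪ Set.range w
    | .inr i, .inl u => (u : V) ∈ (![N₁, N₂] i) ∪ Set.range w
    | .inr _, .inr _ => False
  symm := ⟨by
    rintro (u | i) (v | j) h
    · exact G.adj_symm h
    · exact h
    · exact h
    · exact h⟩
  loopless := ⟨by
    rintro (u | i) h
    · exact G.loopless.irrefl _ h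
    · exact h⟩

/-- The degenerate realisation of a split graph induced by `q`: both `x₁` and `x₂` are placed at
`q x`, all other vertices stay in place. -/
def degenerate {V : Type*} {d : ℕ} {F : Type*} (x : V) (q : Realisation V d F) :
    Realisation (SplitVertex x) d F :=
  Sum.elim (fun v => q v) (fun _ => q x)

end BarJoint

open Filter Topology

/-! ### Derivations and algebraic independence in characteristic zero -/

section Derivations

open scoped IntermediateField.algebraAdjoinAdjoin in
/-- In characteristic zero, a derivation takes arbitrary values on an algebraically independent
family. -/
theorem AlgebraicIndependent.exists_derivation {K L ι : Type*} [Field K] [Field L] [Algebra K L]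
    [CharZero K] {x : ι → L} (hx : AlgebraicIndependent K x) (c : ι → L) :
    ∃ δ : Derivation K L L, ∀ i, δ (x i) = c i := by
  classical
  have : CharZero L := charZero_of_injective_algebraMap (algebraMap K L).injective
  obtain ⟨s, hxs, hs⟩ := exists_isTranscendenceBasis_superset hx.to_subtype_range
  let S := MvPolynomial s K
  let _ : Algebra S L := (MvPolynomial.aeval (R := K) ((↑) : s → L)).toAlgebra
  have : IsScalarTower K S L := IsScalarTower.of_algHom (MvPolynomial.aeval (R := K) ((↑) : s → L))
  have hmap : ∀ P : S, algebraMap S L P = MvPolynomial.aeval ((↑) : s → L) P := fun _ => rfl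
  let A := Algebra.adjoin K (Set.range ((↑) : s → L))
  let F := IntermediateField.adjoin K (Set.range ((↑) : s → L))
  let _ : Algebra S A := hs.1.aevalEquiv.toAlgHom.toAlgebra
  have : IsScalarTower S A L := IsScalarTower.of_algebraMap_eq fun P =>
    (hs.1.algebraMap_aevalEquiv P).symm
  -- `L` is formally étale over the polynomial ring `S` on a transcendence basis: an isomorphism, a
  -- localisation and a separable algebraic extension compose. Hence `Ω[L⁄K]` is the base change of
  -- `Ω[S⁄K]`, and a derivation of `S` into `L` extends to `L`.
  have e1 : Algebra.FormallyEtale S A :=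
    Algebra.FormallyEtale.of_equiv (AlgEquiv.ofBijective (Algebra.ofId S A)
      hs.1.aevalEquiv.bijective)
  have e2 : Algebra.FormallyEtale A F := .of_isLocalization (nonZeroDivisors _)
  have : Algebra.IsAlgebraic F L := by
    have := hs.isAlgebraic_field
    exact this
  have e3 : Algebra.FormallyEtale F L := Algebra.FormallyEtale.of_isSeparable _ L
  have e4 : Algebra.FormallyEtale A L := .comp _ F _
  have e5 : Algebra.FormallyEtale S L := .comp _ A _
  let c' : s → L := fun a => if h : ∃ i, x i = a then c h.choose else 0
  let D : Derivation K S L := MvPolynomial.mkDerivation K c'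
  let Φ : Ω[L⁄K] →ₗ[L] L := (D.liftKaehlerDifferential.liftBaseChange L).comp
    (KaehlerDifferential.tensorKaehlerEquivOfFormallyEtale K S L).symm.toLinearMap
  refine ⟨Φ.compDer (KaehlerDifferential.D K L), fun i => ?_⟩
  have hi : x i ∈ s := hxs ⟨i, rfl⟩
  have h1 : x i = algebraMap S L (MvPolynomial.X ⟨x i, hi⟩) := by simp [hmap]
  have h2 : c' ⟨x i, hi⟩ = c i := by
    have : ∃ j, x j = x i := ⟨i, rfl⟩
    simp only [c', this, dif_pos]
    exact congrArg c (hx.injective this.choose_spec)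
  change D.liftKaehlerDifferential.liftBaseChange L
    ((KaehlerDifferential.tensorKaehlerEquivOfFormallyEtale K S L).symm
      (KaehlerDifferential.D K L (x i))) = c i
  rw [h1, KaehlerDifferential.tensorKaehlerEquivOfFormallyEtale_symm_D_algebraMap]
  simp only [LinearMap.liftBaseChange_tmul, Derivation.liftKaehlerDifferential_comp_D, one_smul]
  exact (MvPolynomial.mkDerivation_X K c' ⟨x i, hi⟩).trans h2

/-- A derivation vanishing on a subfield vanishes on the elements algebraic over it. -/
theorem Derivation.eq_zero_of_isAlgebraic_of_forall_mem {k L : Type*} [Field k] [Field L]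
    [Algebra k L] [CharZero L] (δ : Derivation k L L) (F : IntermediateField k L)
    (hF : ∀ y ∈ F, δ y = 0) {a : L} (ha : IsAlgebraic F a) : δ a = 0 := by
  let D : Derivation F L L := Derivation.mk'
    { toFun := δ
      map_add' := map_add δ
      map_smul' := fun c y => by
        rw [Algebra.smul_def, δ.leibniz]
        simp [hF c c.2, Algebra.smul_def] }
    (fun a b => δ.leibniz a b)
  -- Differentiating the minimal equation of `a` gives `P'(a) • D a = 0`, and `P'(a) ≠ 0` by
  -- separability.
  have h1 := D.map_aeval (minpoly F a) a
  rw [minpoly.aeval, map_zero] at h1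
  have : CharZero F := (algebraMap F L).charZero
  have h2 := (minpoly.irreducible ha.isIntegral).separable.aeval_derivative_ne_zero
    (minpoly.aeval F a)
  exact (smul_eq_zero.1 h1.symm).resolve_left h2

theorem Derivation.eq_zero_of_mem_adjoin {k L : Type*} [Field k] [Field L]
    [Algebra k L] (δ : Derivation k L L) {s : Set L} (hs : ∀ y ∈ s, δ y = 0) {a : L}
    (ha : a ∈ IntermediateField.adjoin k s) : δ a = 0 := by
  induction ha using IntermediateField.adjoin_induction with
  | mem y hy => exact hs y hy
  | algebraMap y => exact δ.map_algebraMap y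
  | add y z _ _ h1 h2 => simp [h1, h2]
  | inv y _ h => simp [Derivation.leibniz_inv, h]
  | mul y z _ _ h1 h2 => simp [h1, h2]

open scoped IntermediateField.algebraAdjoinAdjoin in
/-- A family with a dual family of derivations is algebraically independent. -/
theorem algebraicIndependent_of_dual_derivations {k L ι : Type*} [Field k] [Field L]
    [Algebra k L] [CharZero L] {x : ι → L} (δ : ι → Derivation k L L)
    (h1 : ∀ i, δ i (x i) ≠ 0) (h0 : ∀ i j, i ≠ j → δ i (x j) = 0) :
    AlgebraicIndependent k x := by
  refine algebraicIndependent_of_finite_type' (algebraMap k L).injective fun t _ _ i hi halg => ?_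
  refine h1 i ((δ i).eq_zero_of_isAlgebraic_of_forall_mem
    (IntermediateField.adjoin k (Set.image x t)) (fun y hy => ?_) ?_)
  · refine (δ i).eq_zero_of_mem_adjoin ?_ hy
    rintro _ ⟨j, hj, rfl⟩
    exact h0 i j fun h => hi (h ▸ hj)
  · exact (IsFractionRing.isAlgebraic_iff (Algebra.adjoin k (Set.image x t))
      (IntermediateField.adjoin k (Set.image x t)) L).1 halg

open scoped IntermediateField.algebraAdjoinAdjoin in
/-- If every derivation that kills `s` kills `a`, then `a` is algebraic over `k(s)`. -/
theorem isAlgebraic_adjoin_of_forall_derivation {k L : Type*} [Field k] [Field L] [CharZero k]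
    [Algebra k L] {s : Set L} {a : L}
    (h : ∀ δ : Derivation k L L, (∀ y ∈ s, δ y = 0) → δ a = 0) :
    IsAlgebraic (Algebra.adjoin k s) a := by
  -- If `a` were transcendental over `k(s)`, some derivation over `k(s)` would take the value `1` at
  -- `a`.
  by_contra hna
  have hF : Transcendental (IntermediateField.adjoin k s) a := fun halg =>
    hna ((IsFractionRing.isAlgebraic_iff (Algebra.adjoin k s)
      (IntermediateField.adjoin k s) L).2 halg)
  have hind : AlgebraicIndependent (IntermediateField.adjoin k s) (fun _ : Unit => a) :=
    (algebraicIndependent_unique_type_iff).2 hF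
  have : CharZero (IntermediateField.adjoin k s) :=
    charZero_of_injective_algebraMap (algebraMap k _).injective
  obtain ⟨δ, hδ⟩ := hind.exists_derivation (fun _ => 1)
  have := h (δ.restrictScalars k) fun y hy =>
    δ.map_algebraMap ⟨y, IntermediateField.subset_adjoin k s hy⟩
  have h2 := hδ ()
  change δ a = 0 at this
  simp [this] at h2

end Derivations

namespace BarJoint

/-! ### Infinitesimal motions, congruence and nondegenerate simplices -/

section EdgeForm

variable {V : Type*} {d : ℕ} {F : Type*} [Field F]

/-- Half the derivative of `sqDist (p u) (p v)` in the direction `X`. -/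
def edgeForm (p X : Realisation V d F) (u v : V) : F :=
  ∑ i, (p u i - p v i) * (X u i - X v i)

theorem edgeForm_comm (p X : Realisation V d F) (u v : V) :
    edgeForm p X u v = edgeForm p X v u :=
  Finset.sum_congr rfl fun _ _ => by ring

theorem sqDist_comm (x y : Fin d → F) : sqDist x y = sqDist y x :=
  Finset.sum_congr rfl fun _ _ => by ring

theorem edgeForm_add (p X Y : Realisation V d F) (u v : V) :
    edgeForm p (X + Y) u v = edgeForm p X u v + edgeForm p Y u v := by
  simp only [edgeForm, ← Finset.sum_add_distrib, Pi.add_apply]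
  exact Finset.sum_congr rfl fun _ _ => by ring

theorem edgeForm_smul (p X : Realisation V d F) (c : F) (u v : V) :
    edgeForm p (c • X) u v = c * edgeForm p X u v := by
  simp only [edgeForm, Finset.mul_sum, Pi.smul_apply, smul_eq_mul]
  exact Finset.sum_congr rfl fun _ _ => by ring

theorem edgeForm_sub (p X Y : Realisation V d F) (u v : V) :
    edgeForm p (X - Y) u v = edgeForm p X u v - edgeForm p Y u v := by
  simp only [edgeForm, ← Finset.sum_sub_distrib, Pi.sub_apply]
  exact Finset.sum_congr rfl fun _ _ => by ring

theorem edgeForm_map {F' : Type*} [Field F'] (σ : F →+* F') (p X : Realisation V d F) (u v : V) :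
    edgeForm (fun v i => σ (p v i)) (fun v i => σ (X v i)) u v = σ (edgeForm p X u v) := by
  simp [edgeForm]

/-- The bridge between algebra and rigidity: a derivation applied to all coordinates of `p` is a
velocity field, and it changes squared lengths as a motion would. -/
theorem derivation_sqDist {k : Type*} [Field k] [Algebra k F] (δ : Derivation k F F)
    (p : Realisation V d F) (u v : V) :
    δ (sqDist (p u) (p v)) = 2 * edgeForm p (fun v i => δ (p v i)) u v := by
  simp only [sqDist, edgeForm, map_sum, Finset.mul_sum]
  refine Finset.sum_congr rfl fun i _ => ?_
  rw [pow_two, δ.leibniz, map_sub]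
  simp only [smul_eq_mul]
  ring

/-- Every infinitesimal motion of `(G, p)` is an infinitesimal motion of the complete graph. -/
def HasOnlyTrivialMotions (G : SimpleGraph V) (p : Realisation V d F) : Prop :=
  ∀ X : Realisation V d F, (∀ u v, G.Adj u v → edgeForm p X u v = 0) → ∀ u v, edgeForm p X u v = 0

/-- The rigidity matrix of `(G, p)` has linearly independent rows, in the form: it is surjective
as a linear map. -/
def IsIndependent (G : SimpleGraph V) (p : Realisation V d F) : Prop :=
  ∀ y : V → V → F, (∀ u v, y u v = y v u) →
    ∃ X : Realisation V d F, ∀ u v, G.Adj u v → edgeForm p X u v = y u v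

/-- The matrix with columns `p (b j) - p o`. -/
def frame (p : Realisation V d F) (o : V) (b : Fin d → V) : Matrix (Fin d) (Fin d) F :=
  Matrix.of fun i j => p (b j) i - p o i

theorem frame_apply (p : Realisation V d F) (o : V) (b : Fin d → V) (i j : Fin d) :
    frame p o b i j = p (b j) i - p o i := rfl

open Matrix

theorem transpose_frame_mulVec (p : Realisation V d F) (o : V) (b : Fin d → V) (x : Fin d → F)
    (j : Fin d) : ((frame p o b)ᵀ *ᵥ x) j = ∑ i, (p (b j) i - p o i) * x i := rfl

theorem mulVec_injective_of_det_ne_zero {M : Matrix (Fin d) (Fin d) F} (h : M.det ≠ 0) :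
    Function.Injective M.mulVec :=
  Matrix.mulVec_injective_iff_isUnit.2 ((Matrix.isUnit_iff_isUnit_det M).2 (isUnit_iff_ne_zero.2 h))

theorem inner_eq_of_sqDist_eq [CharZero F] {p q : Realisation V d F}
    (h : ∀ u v, sqDist (p u) (p v) = sqDist (q u) (q v)) (o u v : V) :
    ∑ i, (p u i - p o i) * (p v i - p o i) = ∑ i, (q u i - q o i) * (q v i - q o i) := by
  have key : ∀ r : Realisation V d F, 2 * ∑ i, (r u i - r o i) * (r v i - r o i) =
      sqDist (r u) (r o) + sqDist (r v) (r o) - sqDist (r u) (r v) := fun r => by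
    simp only [sqDist, Finset.mul_sum, ← Finset.sum_add_distrib, ← Finset.sum_sub_distrib]
    exact Finset.sum_congr rfl fun _ _ => by ring
  refine mul_left_cancel₀ (two_ne_zero (α := F)) ?_
  rw [key, key, h, h, h]

/-- Realisations with the same pairwise squared distances are congruent, provided one of them is
affinely spanning. -/
theorem congruent_of_sqDist_eq [CharZero F] {p q : Realisation V d F} {o : V} {b : Fin d → V}
    (hp : (frame p o b).det ≠ 0) (h : ∀ u v, sqDist (p u) (p v) = sqDist (q u) (q v)) :
    Congruent p q := by
  set M := frame p o b
  set N := frame q o b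
  have hM : IsUnit M.det := isUnit_iff_ne_zero.2 hp
  -- By polarisation the Gram matrices agree, so `N` is invertible too and `N * M⁻¹` is orthogonal.
  have hgram : Mᵀ * M = Nᵀ * N := by
    ext j k
    exact inner_eq_of_sqDist_eq h o (b j) (b k)
  have hN : N.det ≠ 0 := fun h0 => by
    have := congrArg Matrix.det hgram
    simp only [Matrix.det_mul, Matrix.det_transpose, h0, mul_zero] at this
    exact hp (mul_self_eq_zero.1 this)
  have hA : (N * M⁻¹)ᵀ * (N * M⁻¹) = 1 := by
    rw [Matrix.transpose_mul, Matrix.mul_assoc, ← Matrix.mul_assoc Nᵀ, ← hgram,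
      Matrix.mul_assoc, Matrix.mul_nonsing_inv _ hM, Matrix.mul_one, ← Matrix.transpose_mul,
      Matrix.mul_nonsing_inv _ hM, Matrix.transpose_one]
  refine ⟨N * M⁻¹, q o - (N * M⁻¹) *ᵥ p o, hA, mul_eq_one_comm.1 hA, fun v => ?_⟩
  have h1 : q v - q o = (N * M⁻¹) *ᵥ (p v - p o) := by
    apply mulVec_injective_of_det_ne_zero (M := Nᵀ) (by rwa [Matrix.det_transpose])
    rw [Matrix.mulVec_mulVec, ← Matrix.mul_assoc, ← hgram, Matrix.mul_assoc,
      Matrix.mul_nonsing_inv _ hM, Matrix.mul_one]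
    ext j
    exact (inner_eq_of_sqDist_eq h o (b j) v).symm
  rw [Matrix.mulVec_sub] at h1
  rw [sub_eq_iff_eq_add.1 h1]
  abel

theorem Congruent.sqDist_eq {p q : Realisation V d F} (h : Congruent p q) (u v : V) :
    sqDist (p u) (p v) = sqDist (q u) (q v) := by
  obtain ⟨A, b, h1, -, h3⟩ := h
  have key : ∀ x y : Fin d → F, sqDist x y = (x - y) ⬝ᵥ (x - y) := fun x y => by
    simp [sqDist, dotProduct, pow_two]
  rw [key, key, h3, h3, add_sub_add_right_eq_sub, ← Matrix.mulVec_sub,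
    Matrix.dotProduct_mulVec, Matrix.vecMul_mulVec, h1, Matrix.vecMul_one]

/-- A motion of the complete graph on an affinely spanning realisation is given by a
skew-symmetric matrix. -/
theorem exists_skew_of_edgeForm_eq_zero [CharZero F] {p X : Realisation V d F} {o : V}
    {b : Fin d → V} (hp : (frame p o b).det ≠ 0) (h : ∀ u v, edgeForm p X u v = 0) :
    ∃ S : Matrix (Fin d) (Fin d) F, Sᵀ = -S ∧ ∀ v, X v - X o = S *ᵥ (p v - p o) := by
  set M := frame p o b
  set N := frame X o b
  have hM : IsUnit M.det := isUnit_iff_ne_zero.2 hp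
  have hMt : IsUnit Mᵀ.det := by rwa [Matrix.det_transpose]
  -- The polarisation identity, differentiated: inner products relative to `o` are infinitesimally
  -- preserved.
  have key : ∀ u v, ∑ i, (p u i - p o i) * (X v i - X o i) =
      -∑ i, (X u i - X o i) * (p v i - p o i) := fun u v => by
    have : ∑ i, (p u i - p o i) * (X v i - X o i) + ∑ i, (X u i - X o i) * (p v i - p o i) =
        edgeForm p X u o + edgeForm p X v o - edgeForm p X u v := by
      simp only [edgeForm, ← Finset.sum_add_distrib, ← Finset.sum_sub_distrib]
      exact Finset.sum_congr rfl fun _ _ => by ring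
    rw [h, h, h] at this
    linear_combination this
  have hskew : Mᵀ * N = -(Nᵀ * M) := by
    ext j k
    exact key (b j) (b k)
  have hS : (N * M⁻¹)ᵀ = -(N * M⁻¹) := by
    have h1 : Mᵀ * (N * M⁻¹) = -Nᵀ := by
      rw [← Matrix.mul_assoc, hskew, Matrix.neg_mul, Matrix.mul_assoc,
        Matrix.mul_nonsing_inv _ hM, Matrix.mul_one]
    have h2 : Mᵀ * (N * M⁻¹)ᵀ = Nᵀ := by
      rw [← Matrix.transpose_mul, Matrix.mul_assoc, Matrix.nonsing_inv_mul _ hM, Matrix.mul_one]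
    have h3 : Mᵀ * (N * M⁻¹)ᵀ = Mᵀ * -(N * M⁻¹) := by rw [h2, Matrix.mul_neg, h1, neg_neg]
    have := congrArg (Mᵀ⁻¹ * ·) h3
    simpa only [Matrix.nonsing_inv_mul_cancel_left _ _ hMt] using this
  refine ⟨N * M⁻¹, hS, fun v => ?_⟩
  apply mulVec_injective_of_det_ne_zero (M := Mᵀ) hMt.ne_zero
  have h1 : Mᵀ * (N * M⁻¹) = -Nᵀ := by
    rw [← Matrix.mul_assoc, hskew, Matrix.neg_mul, Matrix.mul_assoc,
      Matrix.mul_nonsing_inv _ hM, Matrix.mul_one]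
  rw [Matrix.mulVec_mulVec, h1, Matrix.neg_mulVec]
  ext j
  exact key (b j) v

theorem edgeForm_eq_zero_of_skew [CharZero F] {p X : Realisation V d F} {o : V}
    {S : Matrix (Fin d) (Fin d) F} (hS : Sᵀ = -S) (h : ∀ v, X v - X o = S *ᵥ (p v - p o))
    (u v : V) : edgeForm p X u v = 0 := by
  have h1 : X u - X v = S *ᵥ (p u - p v) := by
    rw [← sub_sub_sub_cancel_right (X u) (X v) (X o), h, h, ← Matrix.mulVec_sub,
      sub_sub_sub_cancel_right]
  have h2 : edgeForm p X u v = (p u - p v) ⬝ᵥ (S *ᵥ (p u - p v)) := by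
    rw [← h1]; rfl
  have h3 : (p u - p v) ⬝ᵥ (S *ᵥ (p u - p v)) = -((p u - p v) ⬝ᵥ (S *ᵥ (p u - p v))) := by
    conv_lhs => rw [Matrix.dotProduct_mulVec, ← Matrix.mulVec_transpose, hS, dotProduct_comm,
      Matrix.neg_mulVec, dotProduct_neg]
  rw [h2]
  exact self_eq_neg.1 h3

/-- A square matrix is invertible if every matrix is the sum of a derivative of it and a left
multiple of it. -/
theorem det_ne_zero_of_derivations {k : Type*} [Field k] [Algebra k F]
    (M : Matrix (Fin d) (Fin d) F)
    (h : ∀ X : Matrix (Fin d) (Fin d) F, ∃ (δ : Derivation k F F) (S : Matrix (Fin d) (Fin d) F),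
      X = M.map δ + S * M) : M.det ≠ 0 := by
  intro h0
  -- With `M v = 0` and `u M = 0`, differentiating `M v = 0` gives `(δM) v = -M (δv)`, so `u (δM + S
  -- M) v = 0` for all `δ` and `S`. The matrix unit at nonzero entries `u i`, `v j` violates this.
  obtain ⟨v, hv, hMv⟩ := Matrix.exists_mulVec_eq_zero_iff.2 h0
  obtain ⟨u, hu, huM⟩ := Matrix.exists_vecMul_eq_zero_iff.2 h0
  obtain ⟨i, hi⟩ := Function.ne_iff.1 hu
  obtain ⟨j, hj⟩ := Function.ne_iff.1 hv
  obtain ⟨δ, S, hX⟩ := h (Matrix.single i j 1)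
  have h1 : M.map δ *ᵥ v = -(M *ᵥ fun j => δ (v j)) := by
    ext l
    have := congrArg δ (congrFun hMv l)
    simp only [Matrix.mulVec, dotProduct, map_sum, δ.leibniz, Pi.zero_apply, map_zero,
      Finset.sum_add_distrib, smul_eq_mul] at this
    simp only [Matrix.mulVec, dotProduct, Matrix.map_apply, Pi.neg_apply]
    rw [eq_neg_iff_add_eq_zero, add_comm, ← this]
    simp only [mul_comm]
  have h2 : u ⬝ᵥ (Matrix.single i j 1 *ᵥ v) = 0 := by
    rw [hX, Matrix.add_mulVec, h1, ← Matrix.mulVec_mulVec, hMv, Matrix.mulVec_zero, add_zero,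
      dotProduct_neg, Matrix.dotProduct_mulVec, huM, zero_dotProduct, neg_zero]
  have h3 : Matrix.single i j (1 : F) *ᵥ v = Pi.single i (v j) := by
    rw [Matrix.single_mulVec, one_mul]
    rfl
  rw [h3, dotProduct_single] at h2
  exact mul_ne_zero hi hj h2

/-- For a generic point every velocity comes from a derivation, so the criterion applies with `S =
0`: the derivation kills the coordinates of `o` and moves those of the `b j` freely. -/
theorem IsGeneric.det_frame_ne_zero [CharZero F] {p : Realisation V d F} (hp : IsGeneric p) {o : V}
    {b : Fin d → V} (hb : Function.Injective b) (ho : ∀ j, b j ≠ o) : (frame p o b).det ≠ 0 := by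
  classical
  refine det_ne_zero_of_derivations (k := ℚ) _ fun X => ?_
  obtain ⟨δ, hδ⟩ := hp.exists_derivation
    (fun vi => if h : ∃ j, b j = vi.1 then X vi.2 h.choose else 0)
  refine ⟨δ, 0, ?_⟩
  ext i j
  have h1 : ∃ k, b k = b j := ⟨j, rfl⟩
  have h2 : ¬ ∃ k, b k = o := fun ⟨k, hk⟩ => ho k hk
  have h3 := hδ (b j, i)
  have h4 := hδ (o, i)
  simp only [h1, dif_pos, hb h1.choose_spec] at h3
  simp only [h2, dif_neg, not_false_eq_true] at h4
  simp [frame_apply, h3, h4]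

theorem exists_frame_vertices [Fintype V] (hV : d + 1 ≤ Fintype.card V) :
    ∃ (o : V) (b : Fin d → V), Function.Injective b ∧ ∀ j, b j ≠ o := by
  obtain ⟨e⟩ : Nonempty (Fin (d + 1) ↪ V) :=
    Function.Embedding.nonempty_of_card_le (by simpa using hV)
  exact ⟨e 0, fun j => e j.succ, fun i j h => by simpa using h, fun j h => by simp at h⟩

end EdgeForm


/-! ### The rigidity map, its rank and its kernel -/

section RigidityMap

variable {V : Type*} {d : ℕ} {F : Type*} [Field F]

/-- The rigidity matrix as a linear map. -/
def rigidityMap (G : SimpleGraph V) (p : Realisation V d F) :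
    Realisation V d F →ₗ[F] (G.edgeSet → F) where
  toFun X e := Sym2.lift ⟨edgeForm p X, edgeForm_comm p X⟩ e
  map_add' X Y := by
    ext ⟨e, he⟩
    induction e with | _ u v => exact edgeForm_add p X Y u v
  map_smul' c X := by
    ext ⟨e, he⟩
    induction e with | _ u v => exact edgeForm_smul p X c u v

theorem rigidityMap_apply {G : SimpleGraph V} (p X : Realisation V d F) {u v : V}
    (h : G.Adj u v) : rigidityMap G p X ⟨s(u, v), h⟩ = edgeForm p X u v := rfl

theorem mem_ker_rigidityMap {G : SimpleGraph V} {p X : Realisation V d F} :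
    X ∈ LinearMap.ker (rigidityMap G p) ↔ ∀ u v, G.Adj u v → edgeForm p X u v = 0 := by
  rw [LinearMap.mem_ker]
  refine ⟨fun h u v huv => congrFun h ⟨s(u, v), huv⟩, fun h => ?_⟩
  ext ⟨e, he⟩
  induction e with | _ u v => exact h u v he

theorem rigidityMap_surjective_iff {G : SimpleGraph V} {p : Realisation V d F} :
    Function.Surjective (rigidityMap G p) ↔ IsIndependent G p := by
  classical
  constructor
  · intro h y hy
    obtain ⟨X, hX⟩ := h fun e => Sym2.lift ⟨y, hy⟩ e
    exact ⟨X, fun u v huv => congrFun hX ⟨s(u, v), huv⟩⟩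
  · intro h y
    obtain ⟨X, hX⟩ := h (fun u v => if h : G.Adj u v then y ⟨s(u, v), h⟩ else 0) fun u v => by
      simp only [G.adj_comm v u, Sym2.eq_swap (a := v)]
    refine ⟨X, ?_⟩
    ext ⟨e, he⟩
    induction e with
    | _ u v =>
      have huv : G.Adj u v := he
      rw [rigidityMap_apply p X huv, hX u v huv, dif_pos huv]

theorem finrank_realisation [Fintype V] :
    Module.finrank F (Realisation V d F) = d * Fintype.card V := by
  simp [Realisation, Module.finrank_pi_fintype, mul_comm]

/-- Rank-nullity. All independent realisations of `G` have motion spaces of the same dimension,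
which transfers infinitesimal rigidity between them. -/
theorem IsIndependent.card_add_finrank_ker [Fintype V] {G : SimpleGraph V}
    {p : Realisation V d F} (h : IsIndependent G p) :
    Nat.card G.edgeSet + Module.finrank F (LinearMap.ker (rigidityMap G p)) =
      d * Fintype.card V := by
  classical
  rw [← finrank_realisation (F := F), ← LinearMap.finrank_range_add_finrank_ker (rigidityMap G p),
    LinearMap.range_eq_top.2 (rigidityMap_surjective_iff.2 h), finrank_top,
    Module.finrank_fintype_fun_eq_card, Nat.card_eq_fintype_card]

theorem rank_rigidityMatrix [Fintype V] (G : SimpleGraph V) (p : Realisation V d F) :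
    (rigidityMatrix G p).rank = Module.finrank F (LinearMap.range (rigidityMap G p)) := by
  classical
  have key : (rigidityMatrix G p).mulVecLin ∘ₗ (LinearEquiv.curry F F V (Fin d)).symm.toLinearMap =
      rigidityMap G p := by
    refine LinearMap.ext fun X => funext fun ⟨e, he⟩ => ?_
    induction e with
    | _ u v =>
      have huv : G.Adj u v := he
      have hu : u ∈ s(u, v) := Sym2.mem_mk_left u v
      have hv : v ∈ s(u, v) := Sym2.mem_mk_right u v
      have ou : Sym2.Mem.other hu = v := Sym2.congr_right.1 (Sym2.other_spec hu)
      have ov : Sym2.Mem.other hv = u :=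
        Sym2.congr_right.1 ((Sym2.other_spec hv).trans Sym2.eq_swap)
      rw [rigidityMap_apply p X huv]
      change ∑ vi : V × Fin d, rigidityMatrix G p ⟨s(u, v), he⟩ vi * X vi.1 vi.2 = _
      rw [Fintype.sum_prod_type, Fintype.sum_eq_add u v huv.ne]
      · simp only [rigidityMatrix, dif_pos hu, dif_pos hv, ou, ov, edgeForm,
          ← Finset.sum_add_distrib]
        exact Finset.sum_congr rfl fun _ _ => by ring
      · rintro w ⟨hwu, hwv⟩
        have : w ∉ s(u, v) := by simp [hwu, hwv]
        simp [rigidityMatrix, this]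
  rw [Matrix.rank, ← key, LinearMap.range_comp_of_range_eq_top]
  exact LinearEquiv.range _

theorem card_lt_pairs (d : ℕ) :
    Fintype.card {ij : Fin d × Fin d // ij.1 < ij.2} = d.choose 2 := by
  rw [Fintype.card_subtype, Finset.card_filter, Fintype.sum_prod_type_right]
  have : ∀ j : Fin d, ∑ i : Fin d, (if i < j then 1 else 0) = (j : ℕ) := fun j => by
    rw [← Finset.card_filter, ← Fin.card_Iio j]
    congr 1
    ext i
    simp
  simp only [this]
  rw [Fin.sum_univ_eq_sum_range (fun i => i), Finset.sum_range_id, Nat.choose_two_right]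

open Matrix

/-- The skew-symmetric matrices. -/
def skewMatrices (d : ℕ) (F : Type*) [Field F] : Submodule F (Matrix (Fin d) (Fin d) F) where
  carrier := {S | Sᵀ = -S}
  add_mem' {S T} hS hT := by
    simp only [Set.mem_ofPred_eq] at *
    rw [Matrix.transpose_add, hS, hT, neg_add]
  zero_mem' := by simp
  smul_mem' c S hS := by
    simp only [Set.mem_ofPred_eq] at *
    rw [Matrix.transpose_smul, hS, smul_neg]

theorem finrank_skewMatrices [CharZero F] :
    Module.finrank F (skewMatrices d F) = d.choose 2 := by
  classical
  have hskew : ∀ S ∈ skewMatrices d F, ∀ i j, S j i = -S i j := fun S hS i j =>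
    congrFun (congrFun (show Sᵀ = -S from hS) i) j
  let e : skewMatrices d F ≃ₗ[F] ({ij : Fin d × Fin d // ij.1 < ij.2} → F) :=
    { toFun := fun S ij => S.1 ij.1.1 ij.1.2
      map_add' := fun S T => rfl
      map_smul' := fun c S => rfl
      invFun := fun f => ⟨Matrix.of fun i j => if h : i < j then f ⟨(i, j), h⟩ else
        if h : j < i then -f ⟨(j, i), h⟩ else 0, by
          change Matrix.transpose _ = _
          ext i j
          simp only [Matrix.transpose_apply, Matrix.of_apply, Matrix.neg_apply]
          rcases lt_trichotomy i j with h | h | h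
          · simp [h, h.not_gt]
          · subst h; simp
          · simp [h, h.not_gt]⟩
      left_inv := fun S => by
        ext i j
        simp only [Matrix.of_apply]
        rcases lt_trichotomy i j with h | h | h
        · simp [h]
        · subst h
          have := hskew S.1 S.2 i i
          simpa using (self_eq_neg.1 this).symm
        · simp [h, h.not_gt, hskew S.1 S.2 j i]
      right_inv := fun f => by
        ext ⟨⟨i, j⟩, h⟩
        simp [show i < j from h] }
  rw [e.finrank_eq, Module.finrank_fintype_fun_eq_card, card_lt_pairs]

/-- The space of infinitesimal motions of the complete graph on an affinely spanning realisation
has dimension `d + (d choose 2) = (d + 1 choose 2)`. -/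
theorem finrank_ker_rigidityMap_top [CharZero F] {p : Realisation V d F} {o : V} {b : Fin d → V}
    (hp : (frame p o b).det ≠ 0) :
    Module.finrank F (LinearMap.ker (rigidityMap (⊤ : SimpleGraph V) p)) = (d + 1).choose 2 := by
  -- A translation together with an infinitesimal rotation about `p o`; affine spanning makes the
  -- parametrisation injective.
  let Φ : (Fin d → F) × skewMatrices d F →ₗ[F] Realisation V d F :=
    { toFun := fun tS v => tS.2.1 *ᵥ (p v - p o) + tS.1
      map_add' := fun x y => by
        ext v i
        simp [Matrix.add_mulVec]
        ring
      map_smul' := fun c x => by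
        ext v i
        simp [Matrix.smul_mulVec]
        ring }
  have hinj : Function.Injective Φ := by
    rw [injective_iff_map_eq_zero]
    rintro ⟨t, S, hS⟩ h
    have ht : t = 0 := by simpa [Φ] using congrFun h o
    subst ht
    have hSM : S * frame p o b = 0 := by
      ext i j
      have : (S *ᵥ (p (b j) - p o)) i = 0 := by simpa [Φ] using congrFun (congrFun h (b j)) i
      exact this
    have : S = 0 := by
      have hM : IsUnit (frame p o b).det := isUnit_iff_ne_zero.2 hp
      rw [← Matrix.mul_nonsing_inv_cancel_right _ S hM, hSM, Matrix.zero_mul]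
    subst this
    rfl
  have hrange : LinearMap.range Φ = LinearMap.ker (rigidityMap (⊤ : SimpleGraph V) p) := by
    ext X
    rw [mem_ker_rigidityMap]
    constructor
    · rintro ⟨⟨t, S, hS⟩, rfl⟩ u v -
      exact edgeForm_eq_zero_of_skew (o := o) hS (fun v => by simp [Φ]) u v
    · intro h
      have h' : ∀ u v, edgeForm p X u v = 0 := fun u v => by
        by_cases huv : u = v
        · simp [edgeForm, huv]
        · exact h u v huv
      obtain ⟨S, hS, hX⟩ := exists_skew_of_edgeForm_eq_zero hp h'
      refine ⟨(X o, ⟨S, hS⟩), ?_⟩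
      ext1 v
      exact (sub_eq_iff_eq_add.1 (hX v)).symm
  rw [← hrange, LinearMap.finrank_range_of_inj hinj, Module.finrank_prod, finrank_skewMatrices,
    Module.finrank_fintype_fun_eq_card, Fintype.card_fin, Nat.choose_succ_succ' d 1,
    Nat.choose_one_right]

theorem hasOnlyTrivialMotions_iff {G : SimpleGraph V} {p : Realisation V d F} :
    HasOnlyTrivialMotions G p ↔ LinearMap.ker (rigidityMap G p) ≤
      LinearMap.ker (rigidityMap (⊤ : SimpleGraph V) p) := by
  refine ⟨fun h X hX => mem_ker_rigidityMap.2 fun u v _ => h X (mem_ker_rigidityMap.1 hX) u v,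
    fun h X hX u v => ?_⟩
  by_cases huv : u = v
  · simp [edgeForm, huv]
  · exact mem_ker_rigidityMap.1 (h (mem_ker_rigidityMap.2 hX)) u v huv

theorem ker_rigidityMap_top_le (G : SimpleGraph V) (p : Realisation V d F) :
    LinearMap.ker (rigidityMap (⊤ : SimpleGraph V) p) ≤ LinearMap.ker (rigidityMap G p) :=
  fun _ hX => mem_ker_rigidityMap.2 fun u v huv => mem_ker_rigidityMap.1 hX u v huv.ne

theorem HasOnlyTrivialMotions.finrank_ker [CharZero F] {G : SimpleGraph V}
    {p : Realisation V d F} (h : HasOnlyTrivialMotions G p) {o : V} {b : Fin d → V}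
    (hp : (frame p o b).det ≠ 0) :
    Module.finrank F (LinearMap.ker (rigidityMap G p)) = (d + 1).choose 2 := by
  rw [← finrank_ker_rigidityMap_top hp,
    le_antisymm (hasOnlyTrivialMotions_iff.1 h) (ker_rigidityMap_top_le G p)]

theorem hasOnlyTrivialMotions_of_finrank_ker [Finite V] [CharZero F] {G : SimpleGraph V}
    {p : Realisation V d F} {o : V} {b : Fin d → V} (hp : (frame p o b).det ≠ 0)
    (h : Module.finrank F (LinearMap.ker (rigidityMap G p)) = (d + 1).choose 2) :
    HasOnlyTrivialMotions G p := by
  rw [hasOnlyTrivialMotions_iff]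
  refine (Submodule.eq_of_le_of_finrank_eq (ker_rigidityMap_top_le G p) ?_).ge
  rw [h, finrank_ker_rigidityMap_top hp]

/-- Affine spanning gives the rank condition itself, even for a simplex on `d + 1` vertices, so the
separate simplex clause is not needed. -/
theorem HasOnlyTrivialMotions.isInfinitesimallyRigid [Fintype V] [CharZero F] {G : SimpleGraph V}
    {p : Realisation V d F} (h : HasOnlyTrivialMotions G p) {o : V} {b : Fin d → V}
    (hp : (frame p o b).det ≠ 0) : IsInfinitesimallyRigid G p := by
  left
  rw [rank_rigidityMatrix, ← h.finrank_ker hp, LinearMap.finrank_range_add_finrank_ker,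
    finrank_realisation]

/-- If the rows of the rigidity matrix are dependent, some edge may be deleted without changing
the space of infinitesimal motions. -/
theorem exists_edge_of_not_isIndependent [Finite V] {G : SimpleGraph V} {p : Realisation V d F}
    (h : ¬ IsIndependent G p) : ∃ e ∈ G.edgeSet, ∀ X : Realisation V d F,
      (∀ u v, (G.deleteEdges {e}).Adj u v → edgeForm p X u v = 0) →
        ∀ u v, G.Adj u v → edgeForm p X u v = 0 := by
  classical
  cases nonempty_fintype V
  rw [← rigidityMap_surjective_iff, ← LinearMap.range_eq_top] at h
  -- `φ` is a linear relation among the rows and `e` an edge with nonzero coefficient. For a motion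
  -- of `G - e` only the `e` term of the relation survives, so it vanishes as well.
  obtain ⟨φ, hφ, hle⟩ := Submodule.exists_le_ker_of_lt_top _ (lt_top_iff_ne_top.2 h)
  obtain ⟨e, he⟩ : ∃ e : G.edgeSet, φ (Pi.single e 1) ≠ 0 := by
    by_contra! hcon
    exact hφ (LinearMap.pi_ext' fun e => LinearMap.ext_ring (by simpa using hcon e))
  refine ⟨e, e.2, fun X hX => mem_ker_rigidityMap.1 ?_⟩
  have hsingle : rigidityMap G p X = rigidityMap G p X e • Pi.single e 1 := by
    ext e'
    by_cases hee : e' = e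
    · subst hee; simp
    · rw [Pi.smul_apply, Pi.single_eq_of_ne hee, smul_zero]
      obtain ⟨e', he'⟩ := e'
      induction e' with
      | _ u v =>
        refine hX u v ?_
        rw [SimpleGraph.deleteEdges_adj]
        exact ⟨he', fun h' => hee (Subtype.ext h')⟩
  have h0 : φ (rigidityMap G p X) = 0 := hle ⟨X, rfl⟩
  rw [hsingle, map_smul, smul_eq_mul] at h0
  rw [LinearMap.mem_ker, hsingle, (mul_eq_zero.1 h0).resolve_right he, zero_smul]

end RigidityMap


/-! ### Edge lengths of generic realisations and of their equivalent realisations -/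

section GenericAlgebra

variable {V : Type*} {d : ℕ} {F : Type*} [Field F]

/-- The squared lengths of the edges of `G`. -/
def edgeLengths (G : SimpleGraph V) (p : Realisation V d F) (e : G.edgeSet) : F :=
  Sym2.lift ⟨fun u v => sqDist (p u) (p v), fun _ _ => sqDist_comm _ _⟩ (e : Sym2 V)

theorem edgeLengths_eq_iff {G : SimpleGraph V} {p q : Realisation V d F} :
    edgeLengths G p = edgeLengths G q ↔ Equivalent G p q := by
  refine ⟨fun h u v huv => congrFun h ⟨s(u, v), huv⟩, fun h => funext fun ⟨e, he⟩ => ?_⟩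
  induction e with | _ u v => exact h u v he

/-- If the squared length of `uv` is infinitesimally determined by the edges of `G` at a generic
realisation `p`, then it takes only finitely many values on the realisations equivalent to `p`. -/
theorem IsGeneric.finite_sqDist [CharZero F] {p : Realisation V d F} (hp : IsGeneric p)
    (G : SimpleGraph V) (u v : V)
    (h : ∀ X : Realisation V d F, (∀ a b, G.Adj a b → edgeForm p X a b = 0) →
      edgeForm p X u v = 0) :
    ∃ Z : Set F, Z.Finite ∧ ∀ q, Equivalent G p q → sqDist (q u) (q v) ∈ Z := by
  let S : Set F := {y | ∃ a b, G.Adj a b ∧ sqDist (p a) (p b) = y}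
  have halg : IsAlgebraic (Algebra.adjoin ℚ S) (sqDist (p u) (p v)) := by
    refine isAlgebraic_adjoin_of_forall_derivation fun δ hδ => ?_
    rw [derivation_sqDist, h, mul_zero]
    intro a b hab
    have := hδ _ ⟨a, b, hab, rfl⟩
    rw [derivation_sqDist] at this
    exact (mul_eq_zero.1 this).resolve_left two_ne_zero
  obtain ⟨P, hP0, hP⟩ := halg
  have hinj : Function.Injective (algebraMap (Algebra.adjoin ℚ S) F) := Subtype.val_injective
  refine ⟨(P.map (algebraMap (Algebra.adjoin ℚ S) F)).rootSet F, Polynomial.rootSet_finite _ _,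
    fun q hq => ?_⟩
  let φ : Realisation V d F → MvPolynomial (V × Fin d) ℚ →ₐ[ℚ] F := fun r =>
    MvPolynomial.aeval fun vi => r vi.1 vi.2
  let g : V → V → MvPolynomial (V × Fin d) ℚ := fun a b =>
    ∑ i, (MvPolynomial.X (a, i) - MvPolynomial.X (b, i)) ^ 2
  have hg : ∀ r a b, φ r (g a b) = sqDist (r a) (r b) := fun r a b => by simp [φ, g, sqDist]
  -- The coefficients of `P` are polynomials in edge lengths, so they lift to polynomials in the
  -- coordinates with the same value at `p` and at `q`.
  have hlift : ∀ a ∈ Algebra.adjoin ℚ S, ∃ Q, φ p Q = a ∧ φ q Q = a := by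
    intro a ha
    induction ha using Algebra.adjoin_induction with
    | mem y hy =>
      obtain ⟨a, b, hab, rfl⟩ := hy
      exact ⟨g a b, hg p a b, (hg q a b).trans (hq a b hab).symm⟩
    | algebraMap r => exact ⟨algebraMap _ _ r, AlgHom.commutes _ r, AlgHom.commutes _ r⟩
    | add x y _ _ hx hy =>
      obtain ⟨Q, h1, h2⟩ := hx
      obtain ⟨R, h3, h4⟩ := hy
      exact ⟨Q + R, by rw [map_add, h1, h3], by rw [map_add, h2, h4]⟩
    | mul x y _ _ hx hy =>
      obtain ⟨Q, h1, h2⟩ := hx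
      obtain ⟨R, h3, h4⟩ := hy
      exact ⟨Q * R, by rw [map_mul, h1, h3], by rw [map_mul, h2, h4]⟩
  choose! l hl1 hl2 using hlift
  let Q := ∑ n ∈ Finset.range (P.natDegree + 1), l (P.coeff n) * g u v ^ n
  have hQp : φ p Q = 0 := by
    rw [← hP, Polynomial.aeval_eq_sum_range]
    simp only [Q, map_sum, map_mul, map_pow, hg, hl1 _ (P.coeff _).2]
    rfl
  -- Genericity turns the relation at `p` into a polynomial identity, which then also holds at `q`.
  have hQ : Q = 0 := (injective_iff_map_eq_zero (φ p)).1 hp Q hQp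
  have hQq : Polynomial.aeval (sqDist (q u) (q v)) P = 0 := by
    have : φ q Q = 0 := by rw [hQ, map_zero]
    rw [← this, Polynomial.aeval_eq_sum_range]
    simp only [Q, map_sum, map_mul, map_pow, hg, hl2 _ (P.coeff _).2]
    rfl
  rw [Polynomial.mem_rootSet]
  refine ⟨(Polynomial.map_ne_zero_iff hinj).2 hP0, ?_⟩
  rw [Polynomial.aeval_map_algebraMap, hQq]

/-- The squared edge lengths of an independent generic framework are algebraically independent. -/
theorem IsGeneric.algebraicIndependent_edgeLengths [CharZero F] {p : Realisation V d F}
    (hp : IsGeneric p) {G : SimpleGraph V} (hG : IsIndependent G p) :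
    AlgebraicIndependent ℚ (edgeLengths G p) := by
  classical
  -- Independence gives a velocity changing only the length of `e`, and genericity realises it by a
  -- derivation; these derivations are dual to the edge lengths.
  have hex : ∀ e : G.edgeSet, ∃ δ : Derivation ℚ F F, ∀ e' : G.edgeSet,
      δ (edgeLengths G p e') = 2 * (Pi.single e (1 : F) : G.edgeSet → F) e' := by
    intro e
    obtain ⟨X, hX⟩ := rigidityMap_surjective_iff.2 hG (Pi.single e 1)
    obtain ⟨δ, hδ⟩ := hp.exists_derivation fun vi => X vi.1 vi.2
    refine ⟨δ, fun ⟨e', he'⟩ => ?_⟩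
    rw [← hX]
    have hδ' : (fun v i => δ (p v i)) = X := funext fun v => funext fun i => hδ (v, i)
    induction e' with
    | _ u v =>
      change δ (sqDist (p u) (p v)) = 2 * edgeForm p X u v
      rw [derivation_sqDist, hδ']
  choose δ hδ using hex
  refine algebraicIndependent_of_dual_derivations δ (fun e => ?_) fun e e' hee' => ?_
  · rw [hδ, Pi.single_eq_same]
    simp
  · rw [hδ, Pi.single_eq_of_ne hee'.symm, mul_zero]

/-- On realisations equivalent to an independent generic one, derivations of the ground field
realise all infinitesimal changes of edge lengths. -/
theorem IsGeneric.exists_derivation_of_equivalent [CharZero F] {p q : Realisation V d F}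
    (hp : IsGeneric p) {G : SimpleGraph V} (hG : IsIndependent G p) (hq : Equivalent G p q)
    (y : V → V → F) (hy : ∀ u v, y u v = y v u) :
    ∃ δ : Derivation ℚ F F, ∀ u v, G.Adj u v → edgeForm q (fun v i => δ (q v i)) u v = y u v := by
  -- The derivation is prescribed on the edge lengths, common to `p` and `q`, and only afterwards
  -- applied to the coordinates of `q`, which may satisfy algebraic relations.
  obtain ⟨δ, hδ⟩ := (hp.algebraicIndependent_edgeLengths hG).exists_derivation
    fun e => 2 * Sym2.lift ⟨y, hy⟩ (e : Sym2 V)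
  refine ⟨δ, fun u v huv => ?_⟩
  have h1 : δ (sqDist (p u) (p v)) = 2 * y u v := hδ ⟨s(u, v), huv⟩
  rw [hq u v huv, derivation_sqDist] at h1
  exact mul_left_cancel₀ two_ne_zero h1

theorem IsGeneric.isIndependent_of_equivalent [CharZero F] {p q : Realisation V d F}
    (hp : IsGeneric p) {G : SimpleGraph V} (hG : IsIndependent G p) (hq : Equivalent G p q) :
    IsIndependent G q := fun y hy =>
  let ⟨δ, hδ⟩ := hp.exists_derivation_of_equivalent hG hq y hy
  ⟨fun v i => δ (q v i), hδ⟩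

/-- In a realisation equivalent to an independent generic one, all simplices are nondegenerate as
soon as there are no nontrivial infinitesimal motions and some simplex is nondegenerate. -/
theorem IsGeneric.det_frame_ne_zero_of_equivalent [CharZero F] {p q : Realisation V d F}
    (hp : IsGeneric p) {G : SimpleGraph V} (hG : IsIndependent G p) (hq : Equivalent G p q)
    (hrig : HasOnlyTrivialMotions G q) {o' : V} {b' : Fin d → V} (hq' : (frame q o' b').det ≠ 0)
    {o : V} {b : Fin d → V} (hb : Function.Injective b) (ho : ∀ j, b j ≠ o) :
    (frame q o b).det ≠ 0 := by
  classical
  refine det_ne_zero_of_derivations (k := ℚ) _ fun X => ?_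
  -- `Y` moves the simplex by the columns of `X` and fixes `o`. A derivation with the same effect on
  -- the edges differs from `Y` by a trivial motion, whose skew matrix is the `S` of the determinant
  -- criterion.
  let Y : Realisation V d F := fun v i => if h : ∃ j, b j = v then X i h.choose else 0
  have hYb : ∀ i j, Y (b j) i = X i j := fun i j => by
    have h1 : ∃ k, b k = b j := ⟨j, rfl⟩
    simp only [Y, h1, dif_pos, hb h1.choose_spec]
  have hYo : ∀ i, Y o i = 0 := fun i => by
    have h2 : ¬ ∃ k, b k = o := fun ⟨k, hk⟩ => ho k hk
    simp only [Y, h2, dif_neg, not_false_eq_true]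
  obtain ⟨δ, hδ⟩ := hp.exists_derivation_of_equivalent hG hq (edgeForm q Y) (edgeForm_comm q Y)
  obtain ⟨S, -, hS⟩ := exists_skew_of_edgeForm_eq_zero hq'
    (hrig (Y - fun v i => δ (q v i)) fun u v huv => by rw [edgeForm_sub, hδ u v huv, sub_self])
  refine ⟨δ, S, ?_⟩
  ext i j
  have h1 := congrFun (hS (b j)) i
  have h2 := congrFun (hS o) i
  have h3 : (S * frame q o b) i j =
      (S.mulVec (q (b j) - q o')) i - (S.mulVec (q o - q o')) i := by
    rw [← Pi.sub_apply, ← Matrix.mulVec_sub, sub_sub_sub_cancel_right]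
    rfl
  rw [Matrix.add_apply, h3, ← h1, ← h2]
  simp only [Matrix.map_apply, frame_apply, map_sub, Pi.sub_apply, hYb, hYo]
  ring

/-- A realisation without a nondegenerate simplex lies in a hyperplane. -/
theorem exists_hyperplane_of_det_frame_eq_zero {p : Realisation V d F} (o : V)
    (h : ∀ b : Fin d → V, (frame p o b).det = 0) :
    ∃ c : Fin d → F, c ≠ 0 ∧ ∀ u v, ∑ i, c i * (p u i - p v i) = 0 := by
  classical
  let W := Submodule.span F (Set.range fun v => p v - p o)
  have hW : W ≠ ⊤ := by
    intro hW
    obtain ⟨κ, a, -, hspan, hli⟩ := exists_linearIndependent' F fun v => p v - p o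
    let B := Module.Basis.mk hli (by rw [hspan]; exact hW.ge)
    have : Fintype κ := FiniteDimensional.fintypeBasisIndex B
    have hcard : Fintype.card κ = Fintype.card (Fin d) := by
      rw [← Module.finrank_eq_card_basis B, Module.finrank_fintype_fun_eq_card]
    let e := Fintype.equivOfCardEq hcard
    have hli' : LinearIndependent F (frame p o (a ∘ e.symm)).col := hli.comp e.symm e.symm.injective
    rw [Matrix.linearIndependent_cols_iff_isUnit, Matrix.isUnit_iff_isUnit_det, h] at hli'
    exact not_isUnit_zero hli'
  obtain ⟨φ, hφ, hle⟩ := Submodule.exists_le_ker_of_lt_top _ (lt_top_iff_ne_top.2 hW)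
  have hrep : ∀ x : Fin d → F, φ x = ∑ i, φ (Pi.single i 1) * x i := fun x => by
    conv_lhs => rw [LinearMap.pi_apply_eq_sum_univ φ x]
    refine Finset.sum_congr rfl fun i _ => ?_
    rw [smul_eq_mul, mul_comm]
    congr 2
    ext j
    simp [Pi.single_apply, eq_comm]
  refine ⟨fun i => φ (Pi.single i 1), fun h0 => hφ (LinearMap.ext fun x => ?_), fun u v => ?_⟩
  · rw [hrep]
    exact Finset.sum_eq_zero fun i _ => by
      rw [show φ (Pi.single i 1) = 0 from congrFun h0 i, zero_mul]
  · have hu : φ (p u - p o) = 0 := hle (Submodule.subset_span ⟨u, rfl⟩)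
    have hv : φ (p v - p o) = 0 := hle (Submodule.subset_span ⟨v, rfl⟩)
    have := hrep (p u - p v)
    rw [← sub_sub_sub_cancel_right (p u) (p v) (p o), map_sub, hu, hv, sub_zero,
      sub_sub_sub_cancel_right] at this
    exact this.symm

/-- An independent framework in a hyperplane projects to an independent framework of lower
dimension. -/
theorem IsIndependent.exists_of_hyperplane {m : ℕ} {G : SimpleGraph V}
    {p : Realisation V (m + 1) F} (hp : IsIndependent G p) {c : Fin (m + 1) → F} (hc : c ≠ 0)
    (h : ∀ u v, ∑ i, c i * (p u i - p v i) = 0) :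
    ∃ p' : Realisation V m F, IsIndependent G p' := by
  obtain ⟨k, hk⟩ := Function.ne_iff.1 hc
  simp only [Pi.zero_apply] at hk
  refine ⟨fun v j => p v (k.succAbove j), fun y hy => ?_⟩
  obtain ⟨X, hX⟩ := hp y hy
  -- On the hyperplane the `k`-th coordinate of `p u - p v` is a combination of the others; the
  -- correction term redistributes its contribution to the edge form accordingly.
  refine ⟨fun v j => X v (k.succAbove j) - c (k.succAbove j) / c k * X v k, fun u v huv => ?_⟩
  rw [← hX u v huv, edgeForm, edgeForm, Fin.sum_univ_succAbove _ k]
  have h1 := h u v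
  rw [Fin.sum_univ_succAbove _ k] at h1
  have h2 : p u k - p v k =
      -∑ j, c (k.succAbove j) / c k * (p u (k.succAbove j) - p v (k.succAbove j)) := by
    have : ∑ j, c (k.succAbove j) / c k * (p u (k.succAbove j) - p v (k.succAbove j)) =
        (∑ j, c (k.succAbove j) * (p u (k.succAbove j) - p v (k.succAbove j))) / c k := by
      rw [Finset.sum_div]
      exact Finset.sum_congr rfl fun _ _ => by ring
    rw [this, eq_sub_of_add_eq' h1]
    field_simp
    ring
  rw [h2, neg_mul, Finset.sum_mul, ← Finset.sum_neg_distrib, ← Finset.sum_add_distrib]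
  exact Finset.sum_congr rfl fun _ _ => by ring

end GenericAlgebra

/-! ### Density of generic points -/

section Density

/-- Baire category: there are countably many nonzero rational polynomials, and each is nonzero on a
dense open set, since a polynomial vanishing on a product of infinite sets is zero. -/
theorem dense_setOf_algebraicIndependent (ι : Type*) [Finite ι] :
    Dense {x : ι → ℂ | AlgebraicIndependent ℚ x} := by
  cases nonempty_fintype ι
  have hset : {x : ι → ℂ | AlgebraicIndependent ℚ x} =
      ⋂ P : {P : MvPolynomial ι ℚ // P ≠ 0}, {x | MvPolynomial.aeval x P.1 ≠ 0} := by
    ext x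
    simp only [Set.mem_ofPred_eq, algebraicIndependent_iff, Set.mem_iInter, Subtype.forall]
    exact forall_congr' fun P => not_imp_not.symm
  have hpoly : ∀ (P : MvPolynomial ι ℚ) (x : ι → ℂ),
      MvPolynomial.aeval x P = MvPolynomial.eval x (P.map (algebraMap ℚ ℂ)) := fun P x => by
    rw [MvPolynomial.eval_map, MvPolynomial.aeval_def]
  have : Countable (MvPolynomial ι ℚ) := by
    refine Cardinal.mk_le_aleph0_iff.1
      ((MvPolynomial.cardinalMk_le_max_lift (σ := ι) (R := ℚ)).trans ?_)
    simp
  rw [hset]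
  refine dense_iInter_of_isOpen (fun P => ?_) fun P => ?_
  · simp only [hpoly]
    exact (MvPolynomial.continuous_eval _).isOpen_preimage _ isOpen_ne
  · intro x
    rw [mem_closure_iff_nhds]
    intro U hU
    by_contra hne
    rw [Set.not_nonempty_iff_eq_empty] at hne
    rw [nhds_pi] at hU
    obtain ⟨I, t, ht, htU⟩ := Filter.mem_pi'.1 hU
    refine P.2 (MvPolynomial.map_injective _ (algebraMap ℚ ℂ).injective ?_)
    rw [map_zero]
    refine MvPolynomial.funext_set t (fun i => infinite_of_mem_nhds (x i) (ht i)) fun y hy => ?_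
    rw [map_zero, ← hpoly]
    by_contra hy0
    exact (Set.eq_empty_iff_forall_notMem.1 hne y) ⟨htU fun i _ => hy i trivial, hy0⟩

theorem exists_isGeneric_of_eventually {V : Type*} [Finite V] {d : ℕ} {p : Realisation V d ℂ}
    {P : Realisation V d ℂ → Prop} (h : ∀ᶠ r in 𝓝 p, P r) : ∃ r, IsGeneric r ∧ P r := by
  let e : (V × Fin d → ℂ) ≃ₜ Realisation V d ℂ :=
    { toFun := fun x v i => x (v, i)
      invFun := fun r vi => r vi.1 vi.2
      left_inv := fun _ => rfl
      right_inv := fun _ => rfl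
      continuous_toFun := by fun_prop
      continuous_invFun := by fun_prop }
  have h' : ∀ᶠ x in 𝓝 (e.symm p), P (e x) := by
    have := e.continuous.tendsto (e.symm p)
    rw [e.apply_symm_apply] at this
    exact this.eventually h
  obtain ⟨x, hx1, hx2⟩ := mem_closure_iff_nhds.1
    (dense_setOf_algebraicIndependent (V × Fin d) (e.symm p)) _ h'
  exact ⟨e x, hx2, hx1⟩

end Density

/-! ### Openness of independence and rigidity throughout the fibre -/

section Open

variable {V : Type*} [Finite V] {d : ℕ}

/-- Independence is an open condition. -/
theorem IsIndependent.eventually {G : SimpleGraph V} {p : Realisation V d ℂ}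
    (hp : IsIndependent G p) : ∀ᶠ r in 𝓝 p, IsIndependent G r := by
  classical
  cases nonempty_fintype V
  -- With these velocities held fixed, their images depend continuously on the realisation; linear
  -- independence is open, and the number of vectors makes them span.
  choose X hX using fun e => rigidityMap_surjective_iff.2 hp (Pi.single e 1)
  have hli : LinearIndependent ℂ fun e => rigidityMap G p (X e) := by
    simp only [hX]
    convert (Pi.basisFun ℂ G.edgeSet).linearIndependent with e
    simp
  have hcont : Continuous fun (r : Realisation V d ℂ) (e : G.edgeSet) => rigidityMap G r (X e) := by
    refine continuous_pi fun e => continuous_pi fun ⟨e', he'⟩ => ?_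
    induction e' with
    | _ u v =>
      change Continuous fun r : Realisation V d ℂ => edgeForm r (X e) u v
      unfold edgeForm
      fun_prop
  filter_upwards [hcont.continuousAt.eventually hli.eventually] with r hr
  rw [← rigidityMap_surjective_iff, ← LinearMap.range_eq_top, eq_top_iff,
    ← hr.span_eq_top_of_card_eq_finrank' (by simp), Submodule.span_le]
  rintro _ ⟨e, rfl⟩
  exact ⟨X e, rfl⟩

/-- A generic realisation near an independent one whose space of infinitesimal motions has
dimension `(d + 1 choose 2)` has only trivial infinitesimal motions. -/
theorem IsIndependent.hasOnlyTrivialMotions_of_isGeneric {G : SimpleGraph V}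
    {p r : Realisation V d ℂ} (hp : IsIndependent G p) (hr : IsIndependent G r)
    (hk : Module.finrank ℂ (LinearMap.ker (rigidityMap G p)) = (d + 1).choose 2)
    {o : V} {b : Fin d → V} (hrb : (frame r o b).det ≠ 0) : HasOnlyTrivialMotions G r := by
  cases nonempty_fintype V
  refine hasOnlyTrivialMotions_of_finrank_ker hrb ?_
  have h1 := hp.card_add_finrank_ker
  have h2 := hr.card_add_finrank_ker
  omega

/-- An independent framework attaining the maximal number of edges is affinely spanning. -/
theorem IsIndependent.exists_det_frame_ne_zero [Fintype V] {G : SimpleGraph V}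
    {p : Realisation V d ℂ} (hp : IsIndependent G p) (hV : d + 1 ≤ Fintype.card V)
    (hk : Module.finrank ℂ (LinearMap.ker (rigidityMap G p)) = (d + 1).choose 2) :
    ∃ (o : V) (b : Fin d → V), (frame p o b).det ≠ 0 := by
  by_contra! hcon
  obtain ⟨o, -⟩ := exists_frame_vertices hV
  obtain ⟨c, hc, hpl⟩ := exists_hyperplane_of_det_frame_eq_zero o (hcon o)
  obtain _ | m := d
  · exact hc (Subsingleton.elim _ _)
  obtain ⟨p', hp'⟩ := hp.exists_of_hyperplane hc hpl
  -- The projection itself may be degenerate; a generic `r` nearby spans `m`-space, so its trivial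
  -- motions have full dimension `(m + 1).choose 2`.
  obtain ⟨r, hr, hri⟩ := exists_isGeneric_of_eventually hp'.eventually
  obtain ⟨o', b, hb, ho⟩ := exists_frame_vertices (d := m) (V := V) (by omega)
  -- With `d = m + 1`, the edge count `d|V| - (d + 1 choose 2)` is at most `(d - 1)|V| - (d choose
  -- 2)`, which forces `|V| ≤ d`.
  have h1 := hp.card_add_finrank_ker
  have h2 := hri.card_add_finrank_ker
  have h3 := Submodule.finrank_mono (ker_rigidityMap_top_le G r)
  rw [finrank_ker_rigidityMap_top (hr.det_frame_ne_zero hb ho)] at h3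
  rw [hk, Nat.choose_succ_succ' (m + 1) 1, Nat.choose_one_right, one_add_one_eq_two] at h1
  have h4 : (m + 1) * Fintype.card V = m * Fintype.card V + Fintype.card V := by ring
  omega

/-- Every realisation equivalent to an independent, infinitesimally rigid generic realisation is
infinitesimally rigid, and all its simplices are nondegenerate. -/
theorem IsGeneric.hasOnlyTrivialMotions_of_equivalent [Fintype V] {G : SimpleGraph V}
    {p q : Realisation V d ℂ} (hp : IsGeneric p) (hV : d + 1 ≤ Fintype.card V)
    (hG : IsIndependent G p) (hrig : HasOnlyTrivialMotions G p) (hq : Equivalent G p q) :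
    HasOnlyTrivialMotions G q ∧ ∀ (o : V) (b : Fin d → V), Function.Injective b →
      (∀ j, b j ≠ o) → (frame q o b).det ≠ 0 := by
  obtain ⟨o, b, hb, ho⟩ := exists_frame_vertices hV
  have hqi := hp.isIndependent_of_equivalent hG hq
  have hk : Module.finrank ℂ (LinearMap.ker (rigidityMap G q)) = (d + 1).choose 2 := by
    have h1 := hG.card_add_finrank_ker
    have h2 := hqi.card_add_finrank_ker
    rw [hrig.finrank_ker (hp.det_frame_ne_zero hb ho)] at h1
    omega
  obtain ⟨o', b', hq'⟩ := hqi.exists_det_frame_ne_zero hV hk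
  have hqr := hasOnlyTrivialMotions_of_finrank_ker hq' hk
  exact ⟨hqr, fun o b hb ho => hp.det_frame_ne_zero_of_equivalent hG hq hqr hq' hb ho⟩

end Open


/-! ### Rigidity and infinitesimal rigidity at generic points -/

section Rigid

variable {V : Type*} {d : ℕ}

theorem continuous_sqDist {F : Type*} [Field F] [TopologicalSpace F] [IsTopologicalRing F]
    (u v : V) : Continuous fun r : Realisation V d F => sqDist (r u) (r v) := by
  unfold sqDist
  fun_prop

/-- A squared length that is infinitesimally determined at a generic realisation is constant along
continuous flexes. -/
theorem IsGeneric.sqDist_eq_of_continuousOn {F : Type*} [Field F] [CharZero F]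
    [TopologicalSpace F] [IsTopologicalRing F] [T1Space F] {p : Realisation V d F}
    (hp : IsGeneric p) {G : SimpleGraph V} {u v : V}
    (h : ∀ X : Realisation V d F, (∀ a b, G.Adj a b → edgeForm p X a b = 0) →
      edgeForm p X u v = 0)
    {ε : ℝ} {ρ : ℝ → Realisation V d F} (hρ : ContinuousOn ρ (Set.Ioo (-ε) ε)) (h0 : ρ 0 = p)
    (heq : ∀ t ∈ Set.Ioo (-ε) ε, Equivalent G p (ρ t)) {t : ℝ} (ht : t ∈ Set.Ioo (-ε) ε) :
    sqDist (p u) (p v) = sqDist (ρ t u) (ρ t v) := by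
  obtain ⟨Z, hZ, hmem⟩ := hp.finite_sqDist G u v h
  -- A continuous function from an interval to a finite set is constant.
  obtain ⟨y, -, hy⟩ := isPreconnected_Ioo.eqOn_const_of_mapsTo
    (f := fun t => sqDist (ρ t u) (ρ t v)) (T := Z)
    hZ.isDiscrete ((continuous_sqDist u v).comp_continuousOn hρ) (fun t ht => hmem _ (heq t ht))
    ⟨_, hmem p fun _ _ _ => rfl⟩
  have h0' : (0 : ℝ) ∈ Set.Ioo (-ε) ε := ⟨by linarith [ht.1, ht.2], by linarith [ht.1, ht.2]⟩
  have e1 := hy h0'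
  have e2 := hy ht
  simp only [h0, Function.const_apply] at e1 e2
  rw [e1, e2]

/-- Infinitesimally rigid generic frameworks are rigid. -/
theorem HasOnlyTrivialMotions.isRigidFramework {F : Type*} [Field F] [CharZero F]
    [TopologicalSpace F] [IsTopologicalRing F] [T1Space F] {p : Realisation V d F}
    {G : SimpleGraph V} (h : HasOnlyTrivialMotions G p) (hp : IsGeneric p) {o : V} {b : Fin d → V}
    (hb : (frame p o b).det ≠ 0) : IsRigidFramework G p := fun _ _ hρ _ ht =>
  congruent_of_sqDist_eq hb fun u v =>
    hp.sqDist_eq_of_continuousOn (fun X hX => h X hX u v) hρ.continuousOn hρ.zero hρ.equivalent ht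

/-- A subgraph with the same infinitesimal motions and independent rows. -/
theorem exists_isIndependent_le [Finite V] {F : Type*} [Field F] (G : SimpleGraph V)
    (p : Realisation V d F) : ∃ H ≤ G, IsIndependent H p ∧ ∀ X : Realisation V d F,
      (∀ u v, H.Adj u v → edgeForm p X u v = 0) → ∀ u v, G.Adj u v → edgeForm p X u v = 0 := by
  obtain ⟨H, hH⟩ := (Set.toFinite {H : SimpleGraph V | H ≤ G ∧ ∀ X : Realisation V d F,
    (∀ u v, H.Adj u v → edgeForm p X u v = 0) →
      ∀ u v, G.Adj u v → edgeForm p X u v = 0}).exists_minimal ⟨G, le_rfl, fun _ h => h⟩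
  refine ⟨H, hH.1.1, ?_, hH.1.2⟩
  by_contra hni
  obtain ⟨e, he, hker⟩ := exists_edge_of_not_isIndependent hni
  have hle : H ≤ H.deleteEdges {e} := hH.2
    ⟨(H.deleteEdges_le {e}).trans hH.1.1, fun X hX => hH.1.2 X (hker X hX)⟩ (H.deleteEdges_le {e})
  have := SimpleGraph.edgeSet_mono hle he
  simp [SimpleGraph.edgeSet_deleteEdges] at this

section Analytic

variable {𝕜 : Type*} [RCLike 𝕜]

/-- The coordinate `r ↦ r w i` as a continuous linear map. -/
def coordCLM (𝕜 : Type*) [RCLike 𝕜] (w : V) (i : Fin d) : Realisation V d 𝕜 →L[𝕜] 𝕜 :=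
  (ContinuousLinearMap.proj i : (Fin d → 𝕜) →L[𝕜] 𝕜).comp
    (ContinuousLinearMap.proj w : (V → Fin d → 𝕜) →L[𝕜] (Fin d → 𝕜))

@[simp]
theorem coordCLM_apply (w : V) (i : Fin d) (X : Realisation V d 𝕜) :
    coordCLM 𝕜 w i X = X w i := rfl

variable [Fintype V]

theorem hasStrictFDerivAt_sqDist (p : Realisation V d 𝕜) (u v : V) :
    HasStrictFDerivAt (fun r : Realisation V d 𝕜 => sqDist (r u) (r v))
      (∑ i, (2 * (p u i - p v i)) • (coordCLM 𝕜 u i - coordCLM 𝕜 v i)) p := by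
  have h : ∀ w i, HasStrictFDerivAt (fun r : Realisation V d 𝕜 => r w i) (coordCLM 𝕜 w i) p :=
    fun w i => (coordCLM 𝕜 w i).hasStrictFDerivAt
  refine HasStrictFDerivAt.fun_sum fun i _ => ?_
  refine (((h u i).sub (h v i)).pow 2).congr_fderiv ?_
  ext1 X
  simp

open Classical in
theorem hasStrictFDerivAt_edgeLengths (G : SimpleGraph V) (p : Realisation V d 𝕜) :
    HasStrictFDerivAt (edgeLengths G) ((2 : 𝕜) • (rigidityMap G p).toContinuousLinearMap) p := by
  rw [hasStrictFDerivAt_pi']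
  rintro ⟨e, he⟩
  induction e with
  | _ u v =>
    refine (hasStrictFDerivAt_sqDist p u v).congr_fderiv ?_
    ext1 X
    have : rigidityMap G p X ⟨s(u, v), he⟩ = edgeForm p X u v := rfl
    simp [this, edgeForm, Finset.mul_sum, mul_assoc]

open Classical in
theorem IsIndependent.range_eq_top {G : SimpleGraph V} {p : Realisation V d 𝕜}
    (h : IsIndependent G p) :
    ((2 : 𝕜) • (rigidityMap G p).toContinuousLinearMap).range = ⊤ := by
  rw [LinearMap.range_eq_top]
  intro y
  obtain ⟨X, hX⟩ := rigidityMap_surjective_iff.2 h ((2 : 𝕜)⁻¹ • y)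
  exact ⟨X, by simp [hX]⟩

/-- Rigid generic frameworks are infinitesimally rigid. -/
theorem IsRigidFramework.hasOnlyTrivialMotions {G : SimpleGraph V} {p : Realisation V d 𝕜}
    (h : IsRigidFramework G p) (hp : IsGeneric p) : HasOnlyTrivialMotions G p := by
  classical
  obtain ⟨H, hHG, hH, hker⟩ := exists_isIndependent_le G p
  intro X hX u v
  set f' := (2 : 𝕜) • (rigidityMap H p).toContinuousLinearMap with hf'
  have hf : HasStrictFDerivAt (edgeLengths H) f' p := hasStrictFDerivAt_edgeLengths H p
  have hr : f'.range = ⊤ := hH.range_eq_top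
  have hXk : X ∈ f'.ker := by
    have : rigidityMap H p X = 0 := mem_ker_rigidityMap.2 fun a b hab => hX a b (hHG hab)
    simp [hf', this]
  -- A local parametrisation of the fibre of edge lengths of `H` through `p`, tangent to the kernel;
  -- following the line through `X` yields a flex with initial velocity `X`.
  let g : f'.ker → Realisation V d 𝕜 := hf.implicitFunction _ f' hr (edgeLengths H p)
  have hg0 : g 0 = p := hf.implicitFunction_apply_image hr
  have hg' : HasStrictFDerivAt g f'.ker.subtypeL 0 := hf.to_implicitFunction hr
  have hgf : ∀ᶠ z in 𝓝 (0 : f'.ker), edgeLengths H (g z) = edgeLengths H p := by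
    have hc : Continuous fun z : f'.ker => (edgeLengths H p, z) := by fun_prop
    exact (hc.tendsto 0).eventually (hf.map_implicitFunction_eq hr)
  obtain ⟨K, s, hs, hK⟩ := hg'.exists_lipschitzOnWith
  let γ : ℝ → f'.ker := fun t => (t : 𝕜) • ⟨X, hXk⟩
  have hγ : Continuous γ :=
    (RCLike.continuous_ofReal (K := 𝕜)).fun_smul continuous_const
  have hγ0 : γ 0 = 0 := by simp [γ]
  have hev : ∀ᶠ t in 𝓝 (0 : ℝ), γ t ∈ s ∧ edgeLengths H (g (γ t)) = edgeLengths H p := by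
    have := hγ.tendsto 0
    rw [hγ0] at this
    exact this.eventually (Filter.Eventually.and hs hgf)
  obtain ⟨ε, hε, hball⟩ := Metric.eventually_nhds_iff.1 hev
  have hmem : ∀ t ∈ Set.Ioo (-ε) ε, γ t ∈ s ∧ edgeLengths H (g (γ t)) = edgeLengths H p :=
    fun t ht => hball (by rw [Real.dist_0_eq_abs]; exact abs_lt.2 ht)
  have hcont : ContinuousOn (fun t => g (γ t)) (Set.Ioo (-ε) ε) :=
    hK.continuousOn.comp hγ.continuousOn fun t ht => (hmem t ht).1
  have hflex : IsContinuousFlex G p ε fun t => g (γ t) :=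
    { pos := hε
      continuousOn := hcont
      zero := by rw [hγ0, hg0]
      -- The flex is built to preserve only the edges of `H`; the remaining edges of `G` are
      -- infinitesimally determined by those, hence constant along it.
      equivalent := fun t ht a b hab =>
        hp.sqDist_eq_of_continuousOn (fun Y hY => hker Y hY a b hab) hcont (by rw [hγ0, hg0])
          (fun t ht => edgeLengths_eq_iff.1 (hmem t ht).2.symm) ht }
  have hconst : ∀ t ∈ Set.Ioo (-ε) ε,
      sqDist (p u) (p v) = sqDist (g (γ t) u) (g (γ t) v) := fun t ht =>
    (h ε _ hflex t ht).sqDist_eq u v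
  by_contra hne
  have hder : HasDerivAt (fun z : 𝕜 => sqDist (g (z • ⟨X, hXk⟩) u) (g (z • ⟨X, hXk⟩) v))
      (2 * edgeForm p X u v) 0 := by
    have h1 : HasDerivAt (fun z : 𝕜 => z • (⟨X, hXk⟩ : f'.ker)) ⟨X, hXk⟩ 0 := by
      simpa using (hasDerivAt_id (0 : 𝕜)).smul_const (⟨X, hXk⟩ : f'.ker)
    have h2 : HasFDerivAt g f'.ker.subtypeL ((0 : 𝕜) • (⟨X, hXk⟩ : f'.ker)) := by
      rw [zero_smul]; exact hg'.hasFDerivAt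
    have h3 := h2.comp_hasDerivAt (0 : 𝕜) h1
    have h4 := (hasStrictFDerivAt_sqDist p u v).hasFDerivAt
    have h5 : (g ∘ fun z : 𝕜 => z • (⟨X, hXk⟩ : f'.ker)) 0 = p := by
      rw [Function.comp_apply, zero_smul, hg0]
    rw [← h5] at h4
    have h6 := h4.comp_hasDerivAt (0 : 𝕜) h3
    refine h6.congr_deriv ?_
    rw [h5]
    simp [edgeForm, Finset.mul_sum, mul_assoc]
  -- A nonzero derivative makes the distance differ from its initial value at small nonzero
  -- parameters, against its constancy at real ones.
  have hne' := hder.eventually_ne (c := sqDist (p u) (p v)) (mul_ne_zero two_ne_zero hne)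
  have htend : Tendsto (fun t : ℝ => (t : 𝕜)) (𝓝[≠] 0) (𝓝[≠] 0) := by
    refine tendsto_nhdsWithin_iff.2 ⟨?_, ?_⟩
    · have := (RCLike.continuous_ofReal (K := 𝕜)).tendsto 0
      rw [RCLike.ofReal_zero] at this
      exact this.mono_left nhdsWithin_le_nhds
    · filter_upwards [self_mem_nhdsWithin] with t ht
      simpa using ht
  have hIoo : ∀ᶠ t in 𝓝[≠] (0 : ℝ), t ∈ Set.Ioo (-ε) ε :=
    nhdsWithin_le_nhds (Ioo_mem_nhds (by linarith) hε)
  obtain ⟨t, ht1, ht2⟩ := ((htend.eventually hne').and hIoo).exists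
  exact ht1 (hconst t ht2).symm

end Analytic

variable [Fintype V]

/-- A rigid graph is infinitesimally rigid at every generic complex realisation. -/
theorem IsRigid.hasOnlyTrivialMotions {G : SimpleGraph V} (hG : IsRigid d G)
    {p : Realisation V d ℂ} (hp : IsGeneric p) : HasOnlyTrivialMotions G p := by
  -- One generic realisation suffices, as a field automorphism of `ℂ` carries it to any other and
  -- preserves edge forms. A real realisation is treated by splitting velocities into real and
  -- imaginary parts.
  suffices h : ∃ p₀ : Realisation V d ℂ, IsGeneric p₀ ∧ HasOnlyTrivialMotions G p₀ by
    obtain ⟨p₀, hp₀, h₀⟩ := h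
    obtain ⟨σ, hσ⟩ := exists_ringEquiv hp₀ hp
    have hpσ : p = fun v i => (σ : ℂ →+* ℂ) (p₀ v i) :=
      funext fun v => funext fun i => (hσ (v, i)).symm
    intro X hX u v
    have hXσ : X = fun v i => (σ : ℂ →+* ℂ) (σ.symm (X v i)) := by simp
    rw [hpσ, hXσ, edgeForm_map, h₀ _ fun a b hab => ?_, map_zero]
    have := hX a b hab
    rw [hpσ, hXσ, edgeForm_map] at this
    exact (map_eq_zero_iff _ σ.injective).1 this
  obtain ⟨p₀, hp₀, h₀⟩ | ⟨p₀, hp₀, h₀⟩ := hG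
  · have h₁ := h₀.hasOnlyTrivialMotions hp₀
    refine ⟨fun v i => (p₀ v i : ℂ), ?_, fun X hX u v => ?_⟩
    · exact hp₀.map' (f := Complex.ofRealAm.restrictScalars ℚ) Complex.ofReal_injective
    · have hre : ∀ a b, (edgeForm (fun v i => (p₀ v i : ℂ)) X a b).re =
          edgeForm p₀ (fun v i => (X v i).re) a b := fun a b => by
        simp [edgeForm]
      have him : ∀ a b, (edgeForm (fun v i => (p₀ v i : ℂ)) X a b).im =
          edgeForm p₀ (fun v i => (X v i).im) a b := fun a b => by
        simp [edgeForm]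
      apply Complex.ext
      · rw [hre, h₁ _ fun a b hab => ?_, Complex.zero_re]
        rw [← hre, hX a b hab, Complex.zero_re]
      · rw [him, h₁ _ fun a b hab => ?_, Complex.zero_im]
        rw [← him, hX a b hab, Complex.zero_im]
  · exact ⟨p₀, hp₀, h₀.hasOnlyTrivialMotions hp₀⟩

/-- The rigidity matrix of a minimally rigid graph has independent rows at every generic complex
realisation. -/
theorem IsMinimallyRigid.isIndependent {G : SimpleGraph V} (hG : IsMinimallyRigid d G)
    (hV : d + 1 ≤ Fintype.card V) {p : Realisation V d ℂ} (hp : IsGeneric p) :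
    IsIndependent G p := by
  by_contra hni
  obtain ⟨e, he, hker⟩ := exists_edge_of_not_isIndependent hni
  obtain ⟨o, b, hb, ho⟩ := exists_frame_vertices hV
  refine hG.2 e he (Or.inr ⟨p, hp, HasOnlyTrivialMotions.isRigidFramework (fun X hX => ?_) hp
    (hp.det_frame_ne_zero hb ho)⟩)
  exact hG.1.hasOnlyTrivialMotions hp X (hker X hX)

end Rigid


/-! ### The degenerate realisation of a spider-split -/

section SpiderSplit

variable {V : Type*} {d : ℕ} {x : V} {G : SimpleGraph V} {N₁ N₂ : Set V} {w : Fin d → V}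

/-- The map from the vertices of the split graph that identifies `x₁` and `x₂` with `x`. -/
def collapse (x : V) : SplitVertex x → V :=
  Sum.elim (fun v => v) (fun _ => x)

theorem collapse_surjective (x : V) : Function.Surjective (collapse x) := fun v => by
  by_cases hv : v = x
  · exact ⟨.inr 0, hv.symm⟩
  · exact ⟨.inl ⟨v, hv⟩, rfl⟩

theorem degenerate_eq {F : Type*} (x : V) (q : Realisation V d F) :
    degenerate x q = fun a => q (collapse x a) :=
  funext fun a => by cases a <;> rfl

theorem IsSpiderPartition.adj_of_mem (hw : IsSpiderPartition G x N₁ N₂ w) {u : V} {i : Fin 2}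
    (h : u ∈ (![N₁, N₂] i) ∪ Set.range w) : G.Adj x u := by
  have : u ∈ N₁ ∪ N₂ ∪ Set.range w := by
    obtain h | h := h
    · fin_cases i
      · exact Or.inl (Or.inl h)
      · exact Or.inl (Or.inr h)
    · exact Or.inr h
  rwa [hw.union_eq] at this

theorem IsSpiderPartition.ne (hw : IsSpiderPartition G x N₁ N₂ w) (j : Fin d) : w j ≠ x :=
  (hw.adj_of_mem (i := 0) (Or.inr ⟨j, rfl⟩)).ne'

theorem IsSpiderPartition.collapse_adj (hw : IsSpiderPartition G x N₁ N₂ w) {a b : SplitVertex x}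
    (h : (spiderSplit G x N₁ N₂ w).Adj a b) : G.Adj (collapse x a) (collapse x b) := by
  obtain u | i := a <;> obtain v | j := b
  · exact h
  · exact (hw.adj_of_mem h).symm
  · exact hw.adj_of_mem h
  · exact h.elim

theorem IsSpiderPartition.exists_adj (hw : IsSpiderPartition G x N₁ N₂ w) {u v : V}
    (h : G.Adj u v) : ∃ a b, (spiderSplit G x N₁ N₂ w).Adj a b ∧ collapse x a = u ∧
      collapse x b = v := by
  have key : ∀ v, G.Adj x v → ∃ a b, (spiderSplit G x N₁ N₂ w).Adj a b ∧ collapse x a = x ∧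
      collapse x b = v := by
    intro v h
    have hv : v ∈ N₁ ∪ N₂ ∪ Set.range w := by rw [hw.union_eq]; exact h
    obtain (hv | hv) | hv := hv
    · exact ⟨.inr 0, .inl ⟨v, h.ne'⟩, Or.inl hv, rfl, rfl⟩
    · exact ⟨.inr 1, .inl ⟨v, h.ne'⟩, Or.inl hv, rfl, rfl⟩
    · exact ⟨.inr 0, .inl ⟨v, h.ne'⟩, Or.inr hv, rfl, rfl⟩
  by_cases hu : u = x
  · subst hu
    exact key v h
  · by_cases hv : v = x
    · subst hv
      obtain ⟨a, b, hab, ha, hb⟩ := key u h.symm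
      exact ⟨b, a, hab.symm, hb, ha⟩
    · exact ⟨.inl ⟨u, hu⟩, .inl ⟨v, hv⟩, h, rfl, rfl⟩

theorem IsSpiderPartition.equivalent_degenerate (hw : IsSpiderPartition G x N₁ N₂ w)
    {F : Type*} [Field F] {p q : Realisation V d F} (h : Equivalent G p q) :
    Equivalent (spiderSplit G x N₁ N₂ w) (degenerate x p) (degenerate x q) := by
  intro a b hab
  rw [degenerate_eq, degenerate_eq]
  exact h _ _ (hw.collapse_adj hab)

variable {F : Type*} [Field F] {q : Realisation V d F}

open Matrix

/-- If the `d` legs are in general position at `q`, then the degenerate realisation of the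
spider-split has only trivial infinitesimal motions. -/
theorem IsSpiderPartition.hasOnlyTrivialMotions_degenerate (hw : IsSpiderPartition G x N₁ N₂ w)
    (hq : HasOnlyTrivialMotions G q) (hdet : (frame q x w).det ≠ 0) :
    HasOnlyTrivialMotions (spiderSplit G x N₁ N₂ w) (degenerate x q) := by
  classical
  intro X hX
  -- Comparing the two edges at each leg, the difference of velocities is orthogonal to every `q (w
  -- j) - q x`, and these form a basis.
  have heq : X (.inr 1) = X (.inr 0) := by
    rw [← sub_eq_zero]
    apply mulVec_injective_of_det_ne_zero (M := (frame q x w)ᵀ) (by rwa [det_transpose])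
    rw [mulVec_zero]
    ext j
    have h0 := hX (.inr 0) (.inl ⟨w j, hw.ne j⟩) (Or.inr ⟨j, rfl⟩)
    have h1 := hX (.inr 1) (.inl ⟨w j, hw.ne j⟩) (Or.inr ⟨j, rfl⟩)
    rw [transpose_frame_mulVec, Pi.zero_apply, ← sub_self (0 : F)]
    nth_rewrite 1 [← h0]
    rw [← h1, edgeForm, edgeForm, ← Finset.sum_sub_distrib]
    refine Finset.sum_congr rfl fun i _ => ?_
    simp only [degenerate, Sum.elim_inl, Sum.elim_inr, Pi.sub_apply]
    ring
  let Y : Realisation V d F := fun v => if h : v = x then X (.inr 0) else X (.inl ⟨v, h⟩)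
  have hY : X = fun a => Y (collapse x a) := by
    funext a
    obtain u | i := a
    · simp [Y, collapse, u.2]
    · fin_cases i
      · simp [Y, collapse]
      · simp [Y, collapse, heq]
  have hform : ∀ a b, edgeForm (degenerate x q) X a b =
      edgeForm q Y (collapse x a) (collapse x b) := by
    intro a b
    rw [degenerate_eq, hY]
    rfl
  intro a b
  rw [hform]
  refine hq Y (fun u v huv => ?_) _ _
  obtain ⟨a, b, hab, rfl, rfl⟩ := hw.exists_adj huv
  rw [← hform]
  exact hX a b hab

/-- If the `d` legs are in general position at `q`, then the degenerate realisation of the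
spider-split is independent. -/
theorem IsSpiderPartition.isIndependent_degenerate (hw : IsSpiderPartition G x N₁ N₂ w)
    (hq : IsIndependent G q) (hdet : (frame q x w).det ≠ 0) :
    IsIndependent (spiderSplit G x N₁ N₂ w) (degenerate x q) := by
  classical
  intro y hy
  -- `h` will be the velocity of `x₂` relative to `x₁`; the `d` pairs of leg conditions determine
  -- it.
  obtain ⟨h, hh⟩ : ∃ h : Fin d → F, ∀ j, ∑ i, (q (w j) i - q x i) * h i =
      y (.inr 0) (.inl ⟨w j, hw.ne j⟩) - y (.inr 1) (.inl ⟨w j, hw.ne j⟩) := by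
    obtain ⟨h, hh⟩ := (Matrix.mulVec_surjective_iff_isUnit (A := (frame q x w)ᵀ)).2
      ((Matrix.isUnit_iff_isUnit_det _).2 (by
        rw [det_transpose]; exact isUnit_iff_ne_zero.2 hdet))
      fun j => y (.inr 0) (.inl ⟨w j, hw.ne j⟩) - y (.inr 1) (.inl ⟨w j, hw.ne j⟩)
    exact ⟨h, fun j => congrFun hh j⟩
  -- The value to prescribe on the edge of `G` from `x`: legs and `N₁` take theirs from `x₁`, while
  -- `N₂` takes it from `x₂`, corrected for the extra velocity `h`.
  let A : SplitVertex x → F := fun a =>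
    if collapse x a ∈ N₂ then y (.inr 1) a - ∑ i, (q x i - q (collapse x a) i) * h i
    else y (.inr 0) a
  let y' : V → V → F := fun u v =>
    if hu : u = x then if hv : v = x then 0 else A (.inl ⟨v, hv⟩)
    else if hv : v = x then A (.inl ⟨u, hu⟩) else y (.inl ⟨u, hu⟩) (.inl ⟨v, hv⟩)
  have hy' : ∀ u v, y' u v = y' v u := by
    intro u v
    by_cases hu : u = x <;> by_cases hv : v = x <;> simp only [y', hu, hv, dite_true, dite_false]
    exact hy _ _
  obtain ⟨X, hX⟩ := hq y' hy'
  let X' : Realisation (SplitVertex x) d F := Sum.elim (fun v => X v) ![X x, X x + h]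
  have key : ∀ (i : Fin 2) (u : {v // v ≠ x}), (spiderSplit G x N₁ N₂ w).Adj (.inr i) (.inl u) →
      edgeForm (degenerate x q) X' (.inr i) (.inl u) = y (.inr i) (.inl u) := by
    intro i u hadj
    have hXu : edgeForm q X x u = A (.inl u) := by
      rw [hX x u (hw.adj_of_mem hadj)]
      simp [y', u.2]
    have hmem : (u : V) ∈ (![N₁, N₂] i) ∪ Set.range w := hadj
    fin_cases i
    · have hu : (u : V) ∉ N₂ := by
        obtain h' | h' := hmem
        · exact Set.disjoint_left.1 hw.disjoint₁₂ h'
        · exact Set.disjoint_right.1 hw.disjoint₂ h'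
      change edgeForm q X x u = _
      rw [hXu]
      exact if_neg hu
    · have h1 : edgeForm (degenerate x q) X' (.inr 1) (.inl u) =
          edgeForm q X x u + ∑ i, (q x i - q u i) * h i := by
        rw [edgeForm, edgeForm, ← Finset.sum_add_distrib]
        refine Finset.sum_congr rfl fun i _ => ?_
        simp only [degenerate, X', Sum.elim_inl, Sum.elim_inr, Matrix.cons_val_one,
          Matrix.cons_val_fin_one, Pi.add_apply]
        ring
      change edgeForm (degenerate x q) X' (.inr 1) (.inl u) = y (.inr 1) (.inl u)
      rw [h1, hXu]
      obtain h' | ⟨j, h'⟩ := hmem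
      · have : (u : V) ∈ N₂ := h'
        simp [A, collapse, this]
      · have hu : (u : V) ∉ N₂ := Set.disjoint_right.1 hw.disjoint₂ ⟨j, h'⟩
        obtain ⟨u, hux⟩ := u
        simp only at h'
        subst h'
        have h2 : ∑ i, (q x i - q (w j) i) * h i = -∑ i, (q (w j) i - q x i) * h i := by
          rw [← Finset.sum_neg_distrib]
          exact Finset.sum_congr rfl fun i _ => by ring
        rw [h2, hh j]
        have h3 : A (.inl ⟨w j, hux⟩) = y (.inr 0) (.inl ⟨w j, hux⟩) := if_neg hu
        rw [h3]
        ring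
  refine ⟨X', ?_⟩
  rintro (u | i) (v | j) hadj
  · change edgeForm q X u v = _
    rw [hX u v hadj]
    simp [y', u.2, v.2]
  · rw [edgeForm_comm, hy]
    exact key j u hadj
  · exact key i v hadj
  · exact hadj.elim

end SpiderSplit

/-! ### Persistence and the comparison of realisation numbers -/

/-- Near an independent realisation `q`, the edge lengths realised near `q` are exactly all edge
lengths close to those of `q`. -/
theorem IsIndependent.eventually_exists_equivalent {V : Type*} [Finite V] {d : ℕ}
    {G : SimpleGraph V} {p q : Realisation V d ℂ} (hq : IsIndependent G q)
    (hpq : Equivalent G p q) {U : Set (Realisation V d ℂ)} (hU : U ∈ 𝓝 q) :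
    ∀ᶠ r in 𝓝 p, ∃ s ∈ U, Equivalent G r s := by
  classical
  cases nonempty_fintype V
  -- A strictly differentiable map with surjective derivative is locally open.
  have hmap := (hasStrictFDerivAt_edgeLengths G q).map_nhds_eq_of_surj hq.range_eq_top
  have hU' : Set.image (edgeLengths G) U ∈ 𝓝 (edgeLengths G p) := by
    rw [edgeLengths_eq_iff.2 hpq, ← hmap]
    exact image_mem_map hU
  filter_upwards [(hasStrictFDerivAt_edgeLengths G p).continuousAt hU'] with r hr
  obtain ⟨s, hs, hrs⟩ := hr
  exact ⟨s, hs, edgeLengths_eq_iff.1 hrs.symm⟩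

/-- Reduces the inequality to finite families of congruence classes, so that finiteness of the
realisation number is never needed. -/
theorem enatCard_le_of_forall_finset {α : Type*} {n : ℕ∞}
    (h : ∀ s : Finset α, (s.card : ℕ∞) ≤ n) : ENat.card α ≤ n := by
  cases finite_or_infinite α
  · cases nonempty_fintype α
    simpa using h Finset.univ
  · rw [ENat.card_eq_top_of_infinite, top_le_iff, ENat.eq_top_iff_forall_ge]
    intro m
    obtain ⟨s, hs⟩ := Infinite.exists_subset_card_eq α m
    simpa [hs] using h s

end BarJoint

open BarJoint in
theorem mainTheorem10 {V : Type*} [Fintype V] [DecidableEq V] (d : ℕ) (G : SimpleGraph V)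
    (hV : d + 1 ≤ Fintype.card V) (hG : BarJoint.IsMinimallyRigid d G)
    (x : V) (N₁ N₂ : Set V) (w : Fin d → V) (hw : BarJoint.IsSpiderPartition G x N₁ N₂ w) :
    BarJoint.IsRigid d (BarJoint.spiderSplit G x N₁ N₂ w) ∧
    BarJoint.realisationNumber d G ≤
      BarJoint.realisationNumber d (BarJoint.spiderSplit G x N₁ N₂ w) ∧
    ∀ p q : BarJoint.Realisation V d ℂ, BarJoint.IsGeneric p → BarJoint.Equivalent G p q →
      BarJoint.IsInfinitesimallyRigid (BarJoint.spiderSplit G x N₁ N₂ w)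
        (BarJoint.degenerate x q) ∧
      ∀ U ∈ nhds (BarJoint.degenerate x q), ∀ᶠ r in nhds (BarJoint.degenerate x p),
        ∃ s ∈ U, BarJoint.Equivalent (BarJoint.spiderSplit G x N₁ N₂ w) r s := by
  have hV' : d + 1 ≤ Fintype.card (SplitVertex x) := by
    simp only [SplitVertex, Fintype.card_sum, Fintype.card_fin, Fintype.card_subtype_compl,
      Fintype.card_unique]
    have : Fintype.card {v // v ≠ x} = Fintype.card V - 1 := by
      simp [Fintype.card_subtype_compl]
    omega
  have hdet : ∀ p q : Realisation V d ℂ, IsGeneric p → Equivalent G p q →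
      (frame q x w).det ≠ 0 := fun p q hp hq =>
    (hp.hasOnlyTrivialMotions_of_equivalent hV (hG.isIndependent hV hp)
      (hG.1.hasOnlyTrivialMotions hp) hq).2 x w hw.injective hw.ne
  have hmot : ∀ p q : Realisation V d ℂ, IsGeneric p → Equivalent G p q →
      HasOnlyTrivialMotions (spiderSplit G x N₁ N₂ w) (degenerate x q) := fun p q hp hq =>
    hw.hasOnlyTrivialMotions_degenerate (hp.hasOnlyTrivialMotions_of_equivalent hV
      (hG.isIndependent hV hp) (hG.1.hasOnlyTrivialMotions hp) hq).1 (hdet p q hp hq)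
  have hind : ∀ p q : Realisation V d ℂ, IsGeneric p → Equivalent G p q →
      IsIndependent (spiderSplit G x N₁ N₂ w) (degenerate x q) := fun p q hp hq =>
    hw.isIndependent_degenerate (hp.isIndependent_of_equivalent (hG.isIndependent hV hp) hq)
      (hdet p q hp hq)
  let w' : Fin d → SplitVertex x := fun j => .inl ⟨w j, hw.ne j⟩
  have hframe : ∀ q : Realisation V d ℂ, frame (degenerate x q) (.inr 0) w' = frame q x w :=
    fun _ => rfl
  refine ⟨?_, ?_, fun p q hp hq => ⟨?_, fun U hU => ?_⟩⟩
  · obtain ⟨p, hp⟩ := exists_isGeneric V d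
    have hpp : Equivalent G p p := fun _ _ _ => rfl
    have hi := hind p p hp hpp
    -- The degenerate realisation is not generic, since `x₁` and `x₂` coincide when `d > 0`;
    -- rigidity passes to a generic neighbour, which is still independent and so has a motion space
    -- of the same dimension.
    obtain ⟨r, hr, hri⟩ := exists_isGeneric_of_eventually hi.eventually
    obtain ⟨o, b, hb, ho⟩ := exists_frame_vertices hV'
    have hrb := hr.det_frame_ne_zero hb ho
    refine Or.inr ⟨r, hr, (hi.hasOnlyTrivialMotions_of_isGeneric hri ?_ hrb).isRigidFramework hr
      hrb⟩
    exact (hmot p p hp hpp).finrank_ker (o := .inr 0) (b := w')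
      (by rw [hframe]; exact hdet p p hp hpp)
  · obtain ⟨p, hp⟩ := exists_isGeneric V d
    rw [realisationNumber_eq hV G hp]
    refine enatCard_le_of_forall_finset fun s => ?_
    have hout : ∀ c : RealisationSpace G p, Equivalent G p (Quotient.out c).1 :=
      fun c => (Quotient.out c).2
    -- All pairwise squared distances: a continuous congruence invariant that separates the classes
    -- of the degenerate realisations, with values in a Hausdorff space.
    let D : Realisation (SplitVertex x) d ℂ → SplitVertex x → SplitVertex x → ℂ :=
      fun r a b => sqDist (r a) (r b)
    have hD : Continuous D := continuous_pi fun a => continuous_pi fun b => continuous_sqDist a b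
    let Q : RealisationSpace G p → Realisation (SplitVertex x) d ℂ :=
      fun c => degenerate x (Quotient.out c).1
    have hDQ : ∀ c c', D (Q c) = D (Q c') → c = c' := by
      intro c c' hcc'
      refine Quotient.out_equiv_out.1 (congruent_of_sqDist_eq (hdet p _ hp (hout c)) fun u v => ?_)
      obtain ⟨a, rfl⟩ := collapse_surjective x u
      obtain ⟨b, rfl⟩ := collapse_surjective x v
      have h := congrFun (congrFun hcc' a) b
      simp only [D, Q, degenerate_eq] at h
      exact h
    obtain ⟨U, hU, hdisj⟩ := (s.finite_toSet.image fun c => D (Q c)).t2_separation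
    have hev : ∀ᶠ r in 𝓝 (degenerate x p), ∀ c ∈ s, ∃ t ∈ D ⁻¹' U (D (Q c)),
        Equivalent (spiderSplit G x N₁ N₂ w) r t := by
      refine (Filter.eventually_all_finset s).2 fun c _ => ?_
      exact (hind p _ hp (hout c)).eventually_exists_equivalent
        (hw.equivalent_degenerate (hout c))
        (hD.continuousAt.preimage_mem_nhds ((hU _).2.mem_nhds (hU _).1))
    -- Only finitely many neighbourhoods of `degenerate x p` are intersected, so one generic `r`
    -- serves every class in `s`.
    obtain ⟨r, hr, hrs⟩ := exists_isGeneric_of_eventually hev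
    choose t htU ht using fun c : s => hrs c c.2
    rw [realisationNumber_eq hV' _ hr]
    have hinj : Function.Injective fun c : s =>
        (Quotient.mk (congruenceSetoid (spiderSplit G x N₁ N₂ w) r) ⟨t c, ht c⟩ :
          RealisationSpace (spiderSplit G x N₁ N₂ w) r) := by
      intro c c' hcc'
      have hcong : BarJoint.Congruent (t c) (t c') := Quotient.exact hcc'
      have hDt : D (t c) = D (t c') := funext fun a => funext fun b => hcong.sqDist_eq a b
      have h1 : D (t c) ∈ U (D (Q c)) := htU c
      have h2 : D (t c) ∈ U (D (Q c')) := hDt ▸ htU c'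
      refine Subtype.ext (hDQ _ _ (hdisj.elim ⟨c, c.2, rfl⟩ ⟨c', c'.2, rfl⟩ ?_))
      exact Set.not_disjoint_iff.2 ⟨_, h1, h2⟩
    calc (s.card : ℕ∞) = ENat.card s := by simp
      _ ≤ _ := ENat.card_le_card_of_injective hinj
  · exact (hmot p q hp hq).isInfinitesimallyRigid (o := .inr 0) (b := w')
      (by rw [hframe]; exact hdet p q hp hq)
  · exact (hind p q hp hq).eventually_exists_equivalent (hw.equivalent_degenerate hq) hU
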